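/- Let $(S,\mathcal S)$ be a measurable space and let $\nu$ be a complex measure on $S$ with $\sigma$-finite total variation, $\nu(dx)=\xi(x)\,m(dx)$ with $m$ a $\sigma$-finite positive measure and $\xi:S\to\mathbb C$ measurable, so that $|\nu|(dx)=|\xi(x)|\,m(dx)$. Let $w:S\times S\to\{u\in\mathbb C:|u|\le 1\}$ be measurable and symmetric. *Definitions.* For $n\ge1$ let $$\omega_n(x_1,\dots,x_n)=\prod_{1\le i<j\le n}w(x_i,x_j),\qquad \omega^T_n(x_1,\dots,x_n)=\sum_{G}\ \prod_{\{i,j\}\in E(G)}\bigl[w(x_i,x_j)-1\bigr],$$ where $G$ runs over the connected graphs with vertex set $\{1,\dots,n\}$ (so $\omega^T_1=1$). The absolute pinned cluster expansion is the function $S\to[0,\infty]$ $$|\boldsymbol\Gamma|(\nu)(x)=1+\sum_{n\ge1}\frac1{n!}\int_{S^n}\bigl|\omega^T_{n+1}(x,x_1,\dots,x_n)\bigr|\,|\nu|(dx_1)\cdots|\nu|(dx_n).$$ Let $$\varphi_n(x;x_1,\dots,x_n)=\prod_{1\le i\le n}|w(x,x_i)-1|\prod_{1\le i<j\le n}|w(x_i,x_j)|\quad(\varphi_0=1),$$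 $$B_n(x_0;x_1,\dots,x_n)=\sum_{\tau}\prod_{i=0}^n\varphi_{s_i}\bigl(x_i;x_{(i,1)},\dots,x_{(i,s_i)}\bigr),$$ where $\tau$ runs over the trees with vertex set $\{0,1,\dots,n\}$ rooted at $0$ and $(i,1),\dots,(i,s_i)$ are the children of $i$ in $\tau$. The tree sum is the function $S\to[0,\infty]$ $$\boldsymbol{\mathcal B}(\nu)(x)=1+\sum_{n\ge1}\frac1{n!}\int_{S^n}B_n(x;x_1,\dots,x_n)\,|\nu|(dx_1)\cdots|\nu|(dx_n).$$ For measurable $\Lambda\subset S$ with $|\nu|(\Lambda)<\infty$ let $$\Xi_\Lambda(\nu)=1+\sum_{n\ge1}\frac1{n!}\int_{\Lambda^n}\omega_n(x_1,\dots,x_n)\,\nu(dx_1)\cdots\nu(dx_n).$$ As a formal power series, $\ln\Xi_\Lambda(z\nu)=\sum_{n\ge0}c_nz^n$ is the formal logarithm of the series in $z$ of $\Xi_\Lambda(z\nu)$. As a number, $\ln\Xi_\Lambda(\nu)$ is the value at $t=1$ of the continuous logarithm of $t\mapsto\Xi_\Lambda(t\nu)$, $t\in[0,1]$, that vanishes at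 $t=0$; it is defined if such a continuous logarithm exists. *Claim.* 1. For every $x\in S$, $\;|\boldsymbol\Gamma|(\nu)(x)\le\boldsymbol{\mathcal B}(\nu)(x)$, both term by term, that is, for every $n\ge0$ $$\frac1{n!}\int_{S^n}|\omega^T_{n+1}(x,x_1,\dots,x_n)|\,|\nu|(dx_1)\cdots|\nu|(dx_n)\le\frac1{n!}\int_{S^n}B_n(x;x_1,\dots,x_n)\,|\nu|(dx_1)\cdots|\nu|(dx_n),$$ and as an inequality in $[0,\infty]$. 2. For every measurable $\Lambda\subset S$ with $|\nu|(\Lambda)<\infty$, $\;|\ln\Xi_\Lambda(\nu)|\le\int_\Lambda|\boldsymbol\Gamma|(\nu)(x)\,|\nu|(dx)$, in the following senses. - Term by term: $c_0=0$ and, for every $n\ge0$, $$|c_{n+1}|\le\int_\Lambda\frac1{n!}\int_{S^n}|\omega^T_{n+1}(x,x_1,\dots,x_n)|\,|\nu|(dx_1)\cdots|\nu|(dx_n)\,|\nu|(dx).$$ - As numbers: whenever $\ln\Xi_\Lambda(\nu)$ is defined, the inequality holds in $[0,\infty]$. - If $\int_\Lambda|\boldsymbol\Gamma|(\nu)\,d|\nu|<\infty$,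 then $\ln\Xi_\Lambda(\nu)$ is defined and equals the absolutely convergent sum $\sum_{n}c_n$. -/

import Mathlib

/-!
The complex, possibly infinite measure `ν` on `S` is given as `ν(dx) = ξ(x) m(dx)` with `m` a
σ-finite positive measure and `ξ : S → ℂ` a measurable density; its total variation is
`|ν|(dx) = |ξ(x)| m(dx)`.  Taking `m = |ν|` and `|ξ| = 1` (polar decomposition) one obtains every
complex measure whose total variation is finite or σ-finite.  For `z ∈ ℂ` the measure `zν` has
density `z ξ`.
-/

namespace ClusterExp

open MeasureTheory
open scoped ENNReal Nat

noncomputable section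

variable {S : Type*}

/-- `ω_n(x_1,…,x_n) = ∏_{i<j} w(x_i,x_j)`. -/
def omega (w : S → S → ℂ) {n : ℕ} (x : Fin n → S) : ℂ :=
  ∏ p : Fin n × Fin n with p.1 < p.2, w (x p.1) (x p.2)

open Classical in
/-- The truncated function `ω^T_n(x_1,…,x_n)`: the sum over the connected graphs `G` on the
vertices `1,…,n` of `∏_{{i,j} ∈ E(G)} (w(x_i,x_j) - 1)`; an edge is listed as a pair `i < j`.
For `n = 1` the only graph has no edge and the value is `1`. -/
def omegaT (w : S → S → ℂ) {n : ℕ} (x : Fin n → S) : ℂ :=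
  ∑ G : SimpleGraph (Fin n) with G.Connected,
    ∏ p : Fin n × Fin n with p.1 < p.2 ∧ G.Adj p.1 p.2, (w (x p.1) (x p.2) - 1)

/-- The vertex weight `φ_s(x; (y_i)_{i ∈ C})`, with `s = |C|`:
`∏_{i ∈ C} |w(x,y_i) - 1| · ∏_{i<j in C} |w(y_i,y_j)|`. -/
def phi (w : S → S → ℂ) (x : S) {ι : Type*} [LinearOrder ι] (C : Finset ι) (y : ι → S) : ℝ≥0∞ :=
  (∏ i ∈ C, ‖w x (y i) - 1‖ₑ) * ∏ p ∈ C ×ˢ C with p.1 < p.2, ‖w (y p.1) (y p.2)‖ₑ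

open Classical in
/-- The children of the vertex `i` in a tree on `{0,…,n}` rooted at `0`: the neighbours of `i`
that lie one generation further from the root. -/
def children {n : ℕ} (τ : SimpleGraph (Fin (n + 1))) (i : Fin (n + 1)) : Finset (Fin (n + 1)) :=
  {j | τ.Adj i j ∧ τ.dist 0 j = τ.dist 0 i + 1}

open Classical in
/-- `B_n(x_0; x_1,…,x_n)`: the sum over the trees `τ` on `{0,…,n}` rooted at `0` of the product
over the vertices `i` of `φ_{s_i}(x_i; x_{(i,1)},…,x_{(i,s_i)})`, where `(i,1),…,(i,s_i)` are the
children of `i` in `τ`. -/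
def treeWeight (w : S → S → ℂ) {n : ℕ} (x : Fin (n + 1) → S) : ℝ≥0∞ :=
  ∑ τ : SimpleGraph (Fin (n + 1)) with τ.IsTree, ∏ i, phi w (x i) (children τ i) x

variable [MeasurableSpace S]

/-- The total variation `|ν|` of `ν(dx) = ξ(x) m(dx)`. -/
def absMeasure (m : Measure S) (ξ : S → ℂ) : Measure S :=
  m.withDensity fun x => ‖ξ x‖ₑ

/-- The `n`-th term `(1/n!) ∫_{S^n} |ω^T_{n+1}(x,x_1,…,x_n)| |ν|(dx_1)⋯|ν|(dx_n)` of the absolute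
pinned cluster expansion. -/
def absGammaTerm (w : S → S → ℂ) (m : Measure S) (ξ : S → ℂ) (n : ℕ) (x : S) : ℝ≥0∞ :=
  (n ! : ℝ≥0∞)⁻¹ * ∫⁻ y : Fin n → S, ‖omegaT w (Fin.cons x y : Fin (n + 1) → S)‖ₑ
    ∂(Measure.pi fun _ => absMeasure m ξ)

/-- The absolute pinned cluster expansion `|Γ|(ν)(x)`, with values in `[0,∞]`. -/
def absGamma (w : S → S → ℂ) (m : Measure S) (ξ : S → ℂ) (x : S) : ℝ≥0∞ :=
  1 + ∑' n : ℕ, absGammaTerm w m ξ (n + 1) x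

/-- The `n`-th term `(1/n!) ∫_{S^n} B_n(x;x_1,…,x_n) |ν|(dx_1)⋯|ν|(dx_n)` of the tree sum. -/
def treeSumTerm (w : S → S → ℂ) (m : Measure S) (ξ : S → ℂ) (n : ℕ) (x : S) : ℝ≥0∞ :=
  (n ! : ℝ≥0∞)⁻¹ * ∫⁻ y : Fin n → S, treeWeight w (Fin.cons x y : Fin (n + 1) → S)
    ∂(Measure.pi fun _ => absMeasure m ξ)

/-- The tree sum `𝓑(ν)(x)`, with values in `[0,∞]`. -/
def treeSum (w : S → S → ℂ) (m : Measure S) (ξ : S → ℂ) (x : S) : ℝ≥0∞ :=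
  1 + ∑' n : ℕ, treeSumTerm w m ξ (n + 1) x

/-- The `n`-th term `(1/n!) ∫_{Λ^n} ω_n(x_1,…,x_n) ν(dx_1)⋯ν(dx_n)` of the partition function
(for `n = 0` it is `1`). -/
def partitionTerm (w : S → S → ℂ) (m : Measure S) (ξ : S → ℂ) (Λ : Set S) (n : ℕ) : ℂ :=
  (n ! : ℂ)⁻¹ * ∫ x in Set.univ.pi fun _ : Fin n => Λ, omega w x * ∏ i, ξ (x i)
    ∂(Measure.pi fun _ => m)

/-- The grand-canonical partition function `Ξ_Λ(ν)`. -/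
def partitionFunction (w : S → S → ℂ) (m : Measure S) (ξ : S → ℂ) (Λ : Set S) : ℂ :=
  1 + ∑' n : ℕ, partitionTerm w m ξ Λ (n + 1)

/-- The formal power series in `z` of `Ξ_Λ(zν)`. -/
def partitionSeries (w : S → S → ℂ) (m : Measure S) (ξ : S → ℂ) (Λ : Set S) : PowerSeries ℂ :=
  PowerSeries.mk (partitionTerm w m ξ Λ)

/-- The formal power series in `z` of `ln Ξ_Λ(zν)`. -/
def logPartitionSeries (w : S → S → ℂ) (m : Measure S) (ξ : S → ℂ) (Λ : Set S) : PowerSeries ℂ :=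
  PowerSeries.logOf (partitionSeries w m ξ Λ)

/-- `L` is the value of `ln Ξ_Λ(ν)`: the value at `t = 1` of the continuous logarithm of
`t ↦ Ξ_Λ(tν)` on `[0,1]` that vanishes at `t = 0`, where `Ξ_Λ = 1`.  There is at most one
such `L`, and for positive `Ξ_Λ(tν)` it is the real logarithm. -/
def IsLogPartition (w : S → S → ℂ) (m : Measure S) (ξ : S → ℂ) (Λ : Set S) (L : ℂ) : Prop :=
  ∃ l : ℝ → ℂ, ContinuousOn l (Set.Icc 0 1) ∧ l 0 = 0 ∧ l 1 = L ∧
    ∀ t ∈ Set.Icc (0 : ℝ) 1,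
      Complex.exp (l t) = partitionFunction w m (fun x => (t : ℂ) * ξ x) Λ

end

end ClusterExp

namespace ClusterExp

open MeasureTheory
open scoped ENNReal Nat

/-! ### The formal logarithm as the solution of `f * g' = f'` -/

section FormalLog

open PowerSeries

/-! The bound by the tree sum rests on Penrose's tree-graph identity. Join every vertex other than
the root to the least of its neighbours one generation closer to the root. This sends connected
graphs to trees, and the fibre over a tree `T` is the whole interval from `T` to `T ⊔ penroseExtra T
r`. Summing the weights w - 1 over the optional edges produces factors 1 + (w - 1) = w, so ω^T
becomes a sum over trees (`sum_connected_eq_sum_isTree`). As |w| ≤ 1, all optional edges except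
those between siblings may be dropped from the absolute value, and what is left is B_n
(`enorm_omegaT_le_treeWeight`).

For the logarithm, ω is the sum over all graphs. Splitting off the connected component of one vertex
and integrating gives a binomial recursion between the integrals of ω and of ω^T
(`graphIntegral_fin_succ`). For exponential generating series this reads F' = F l', whence c_n =
(1/n!) ∫_{Λ^n} ω^T_n dν^n (`coeff_logPartitionSeries`). Taking moduli, pinning the first point,
letting the others range over S and using 1/(n+1)! ≤ 1/n! bounds c_{n+1}.

If ∫_Λ |Γ| d|ν| is finite, the c_n are absolutely summable, and F' = F l' makes ∑ c_n t^n a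
continuous logarithm of Ξ_Λ(tν) on [0,1]. Such a logarithm is unique, so the bound holds for every
admissible value. If the integral is infinite, the numerical bound is trivial. -/

theorem mul_derivative_logOf {f : PowerSeries ℂ} (hf : constantCoeff f = 1) :
    f * d⁄dX ℂ (logOf f) = d⁄dX ℂ f := by
  have hs : HasSubst (f - 1) := HasSubst.of_constantCoeff_zero' (by simp [hf])
  -- The derivative of ln(1+X) is the alternating geometric series. Substituting f - 1 for X turns 1
  -- + X into f, and the chain rule gives the claim.
  have h1 : (1 + X) * d⁄dX ℂ (log ℂ) = 1 := by
    rw [deriv_log]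
    ext n
    rw [add_mul, one_mul, map_add, coeff_mk]
    rcases n with _ | n
    · simp
    · rw [coeff_succ_X_mul, coeff_mk, coeff_one, if_neg n.succ_ne_zero]
      simp [pow_succ]
  have h2 := congrArg (subst (f - 1)) h1
  have hone : subst (f - 1) (1 : PowerSeries ℂ) = (1 : PowerSeries ℂ) := by
    rw [← coe_substAlgHom hs, map_one]
  rw [subst_mul hs, subst_add hs, subst_X hs, hone, add_sub_cancel] at h2
  rw [logOf_eq, derivative_subst hs, ← mul_assoc]
  erw [h2]
  rw [one_mul, map_sub, derivative_one, sub_zero]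

/-- Cancelling f fixes the derivative of g, and the constant term fixes g. A recursion on
coefficients thus suffices to identify a logarithm. -/
theorem eq_logOf_of_mul_derivative {f g : PowerSeries ℂ} (hf : constantCoeff f = 1)
    (hg : constantCoeff g = 0) (h : f * d⁄dX ℂ g = d⁄dX ℂ f) : g = logOf f := by
  have hf0 : f ≠ 0 := by
    rintro rfl
    simp at hf
  refine derivative.ext (mul_left_cancel₀ hf0 (h.trans (mul_derivative_logOf hf).symm)) ?_
  rw [hg, constantCoeff_logOf hf]

end FormalLog

/-! ### Power series on [0,1] and continuous logarithms -/

section Analysis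

theorem hasDerivAt_tsum_mul_pow {a : ℕ → ℂ} (ha : Summable fun n => ‖a n‖) {z : ℂ}
    (hz : ‖z‖ < 1) :
    HasDerivAt (fun z => ∑' n, a n * z ^ n) (∑' n, (n + 1) * a (n + 1) * z ^ n) z := by
  obtain ⟨r, hzr, hr1⟩ := exists_between hz
  have hr0 : 0 ≤ r := (norm_nonneg z).trans hzr.le
  set M := ∑' n, ‖a n‖
  have hM : ∀ n, ‖a n‖ ≤ M := fun n => ha.le_tsum n fun _ _ => norm_nonneg _
  have hgeo : Summable fun n : ℕ => ((n : ℝ) + 1) * r ^ n := by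
    have h1 := summable_pow_mul_geometric_of_norm_lt_one 1
      (show ‖r‖ < 1 by rwa [Real.norm_of_nonneg hr0])
    have h2 := summable_geometric_of_lt_one hr0 hr1
    simpa [add_mul] using h1.add h2
  have hu : Summable fun n : ℕ => M * (n * r ^ (n - 1)) := by
    refine Summable.mul_left _ ((summable_nat_add_iff 1).1 ?_)
    simpa using hgeo
  -- Termwise differentiation on the ball of radius r, |z| < r < 1, where the derivatives are
  -- dominated by M n r^(n-1).
  have hd := hasDerivAt_tsum_of_isPreconnected (𝕜 := ℂ) (g := fun n z => a n * z ^ n)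
    (g' := fun n z => a n * (n * z ^ (n - 1))) (t := Metric.ball 0 r) (y₀ := 0) (y := z) hu
    Metric.isOpen_ball (convex_ball (0 : ℂ) r).isPreconnected
    (fun n y _ => (hasDerivAt_pow n y).const_mul (a n))
    (fun n y hy => by
      rw [norm_mul, norm_mul, norm_pow, Complex.norm_natCast]
      have hy' : ‖y‖ ≤ r := by simpa using (Metric.mem_ball.1 hy).le
      have := hM n
      gcongr)
    (by simpa using (norm_nonneg z).trans_lt hzr)
    (summable_of_ne_finset_zero (s := {0}) fun n hn => by
      rw [zero_pow (by simpa using hn), mul_zero])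
    (by simpa using hzr)
  have hs : Summable fun n : ℕ => a n * (n * z ^ (n - 1)) := by
    refine Summable.of_norm_bounded hu fun n => ?_
    rw [norm_mul, norm_mul, norm_pow, Complex.norm_natCast]
    have := hM n
    gcongr
  rw [hs.tsum_eq_zero_add] at hd
  simp only [Nat.cast_zero, zero_mul, mul_zero, zero_add, Nat.add_sub_cancel, Nat.cast_add,
    Nat.cast_one] at hd
  rw [tsum_congr fun n : ℕ => show (n + 1) * a (n + 1) * z ^ n = a (n + 1) * ((n + 1) * z ^ n) by
    ring]
  exact hd

theorem summable_norm_succ_mul_pow {a : ℕ → ℂ} (ha : Summable fun n => ‖a n‖) {z : ℂ}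
    (hz : ‖z‖ < 1) : Summable fun n : ℕ => ‖(n + 1) * a (n + 1) * z ^ n‖ := by
  have h1 := summable_pow_mul_geometric_of_norm_lt_one 1
      (show ‖‖z‖‖ < 1 by rwa [norm_norm])
  have h2 := summable_geometric_of_lt_one (norm_nonneg z) hz
  have hgeo : Summable fun n : ℕ => (∑' n, ‖a n‖) * (((n : ℝ) + 1) * ‖z‖ ^ n) :=
    Summable.mul_left _ (by simpa [add_mul] using h1.add h2)
  refine Summable.of_nonneg_of_le (fun _ => norm_nonneg _) (fun n => ?_) hgeo
  have hM := ha.le_tsum (n + 1) fun _ _ => norm_nonneg _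
  have hn : ‖(n + 1 : ℂ)‖ = n + 1 := by
    exact_mod_cast Complex.norm_natCast (n + 1)
  rw [norm_mul, norm_mul, norm_pow, hn, mul_comm ((n : ℝ) + 1), mul_assoc]
  gcongr

theorem summable_norm_mul_pow {a : ℕ → ℂ} (ha : Summable fun n => ‖a n‖) {z : ℂ}
    (hz : ‖z‖ ≤ 1) : Summable fun n : ℕ => ‖a n * z ^ n‖ := by
  refine Summable.of_nonneg_of_le (fun _ => norm_nonneg _) (fun n => ?_) ha
  rw [norm_mul, norm_pow]
  exact mul_le_of_le_one_right (norm_nonneg _) (pow_le_one₀ (norm_nonneg _) hz)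

theorem continuousOn_tsum_mul_ofReal_pow {a : ℕ → ℂ} (ha : Summable fun n => ‖a n‖) :
    ContinuousOn (fun t : ℝ => ∑' n, a n * (t : ℂ) ^ n) (Set.Icc 0 1) := by
  refine continuousOn_tsum (fun n => by fun_prop) ha fun n t ht => ?_
  rw [norm_mul, norm_pow, Complex.norm_real, Real.norm_of_nonneg ht.1]
  exact mul_le_of_le_one_right (norm_nonneg _) (pow_le_one₀ ht.1 ht.2)

/-- If two absolutely convergent power series satisfy `F' = F l'`, `F(0) = 1`, `l(0) = 0`
formally, then `exp l = F` on `[0, 1]`. -/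
theorem exp_tsum_eq_tsum {a c : ℕ → ℂ} (ha : Summable fun n => ‖a n‖)
    (hc : Summable fun n => ‖c n‖) (ha0 : a 0 = 1) (hc0 : c 0 = 0)
    (hrec : ∀ n : ℕ, (n + 1) * a (n + 1) =
      ∑ p ∈ Finset.HasAntidiagonal.antidiagonal n, a p.1 * ((p.2 + 1) * c (p.2 + 1)))
    {t : ℝ} (ht : t ∈ Set.Icc (0 : ℝ) 1) :
    Complex.exp (∑' n, c n * (t : ℂ) ^ n) = ∑' n, a n * (t : ℂ) ^ n := by
  set l : ℝ → ℂ := fun t => ∑' n, c n * (t : ℂ) ^ n with hl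
  set F : ℝ → ℂ := fun t => ∑' n, a n * (t : ℂ) ^ n with hF
  have hlc : ContinuousOn l (Set.Icc 0 1) := continuousOn_tsum_mul_ofReal_pow hc
  have hFc : ContinuousOn F (Set.Icc 0 1) := continuousOn_tsum_mul_ofReal_pow ha
  -- H = F exp(-l) has derivative zero by F' = F l'. The endpoint 1, where the series need not be
  -- differentiable, is reached by continuity.
  set H : ℝ → ℂ := fun t => F t * Complex.exp (-l t) with hH
  have hHc : ContinuousOn H (Set.Icc 0 1) := hFc.mul (hlc.neg.cexp)
  have hderiv : ∀ x ∈ Set.Ico (0 : ℝ) 1, HasDerivWithinAt H 0 (Set.Ici x) x := by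
    intro x hx
    have hx1 : ‖(x : ℂ)‖ < 1 := by
      rw [Complex.norm_real, Real.norm_of_nonneg hx.1]
      exact hx.2
    have h1 := (hasDerivAt_tsum_mul_pow ha hx1).comp_ofReal
    have h2 := (hasDerivAt_tsum_mul_pow hc hx1).comp_ofReal
    have hmul : (∑' n : ℕ, (n + 1) * a (n + 1) * (x : ℂ) ^ n) =
        F x * ∑' n : ℕ, (n + 1) * c (n + 1) * (x : ℂ) ^ n := by
      simp only [hF]
      rw [tsum_mul_tsum_eq_tsum_sum_antidiagonal_of_summable_norm
        (summable_norm_mul_pow ha hx1.le) (summable_norm_succ_mul_pow hc hx1)]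
      refine tsum_congr fun n => ?_
      rw [hrec n, Finset.sum_mul]
      refine Finset.sum_congr rfl fun p hp => ?_
      rw [← Finset.HasAntidiagonal.mem_antidiagonal.1 hp, pow_add]
      ring
    have h3 := (h1.mul (h2.neg.cexp)).hasDerivWithinAt (s := Set.Ici x)
    rw [hmul] at h3
    refine h3.congr_deriv ?_
    change F x * _ * _ + F x * (_ * _) = 0
    ring
  have hc' := constant_of_has_deriv_right_zero hHc hderiv t ht
  have hz : ∀ b : ℕ → ℂ, ∑' n, b n * ((0 : ℝ) : ℂ) ^ n = b 0 := fun b => by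
    rw [tsum_eq_single 0 fun n hn => by simp [hn]]
    simp
  have hH0 : H 0 = 1 := by
    simp only [hH, hF, hl, hz, ha0, hc0]
    simp
  rw [hH0] at hc'
  have h4 : F t * Complex.exp (-l t) * Complex.exp (l t) = Complex.exp (l t) := by
    rw [show F t * Complex.exp (-l t) = 1 from hc', one_mul]
  rw [mul_assoc, ← Complex.exp_add, neg_add_cancel, Complex.exp_zero, mul_one] at h4
  exact h4.symm

/-- Two points with the same exponential differ by a multiple of 2πi, and the open strip of height
2π around x has room for one of them only. -/
theorem isLocallyInjective_exp : IsLocallyInjective Complex.exp := by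
  intro x
  refine ⟨{z | |z.im - x.im| < Real.pi}, isOpen_lt (by fun_prop) (by fun_prop),
    by simp [Real.pi_pos], ?_⟩
  intro z hz z' hz' h
  obtain ⟨n, hn⟩ := Complex.exp_eq_exp_iff_exists_int.1 h
  have him : z.im = z'.im + n * (2 * Real.pi) := by
    have := congrArg Complex.im hn
    simpa using this
  have h1 := abs_lt.1 (show |z.im - x.im| < Real.pi from hz)
  have h2 := abs_lt.1 (show |z'.im - x.im| < Real.pi from hz')
  have hpi := Real.pi_pos
  have hlt : (n : ℝ) < 1 := by
    by_contra hcon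
    push Not at hcon
    nlinarith
  have hgt : (-1 : ℝ) < n := by
    by_contra hcon
    push Not at hcon
    nlinarith
  have hn0 : n = 0 := by
    have h3 : n < 1 := by exact_mod_cast hlt
    have h4 : -1 < n := by exact_mod_cast hgt
    omega
  simpa [hn0] using hn

/-- Two continuous logarithms on `[0, 1]` of the same function that agree at `0` agree. -/
theorem eqOn_of_exp_eq {l l' : ℝ → ℂ} (hl : ContinuousOn l (Set.Icc 0 1))
    (hl' : ContinuousOn l' (Set.Icc 0 1)) (h0 : l 0 = l' 0)
    (h : ∀ t ∈ Set.Icc (0 : ℝ) 1, Complex.exp (l t) = Complex.exp (l' t)) :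
    Set.EqOn l l' (Set.Icc 0 1) :=
  (T2Space.isSeparatedMap Complex.exp).eqOn_of_comp_eqOn isLocallyInjective_exp
    isPreconnected_Icc hl hl' h (Set.left_mem_Icc.2 zero_le_one) h0

end Analysis

/-! ### Penrose trees and the tree-graph identity -/

section Penrose

open Classical

variable {V : Type*}

/-- `k` is a neighbour of `j` one generation closer to the root `r`. -/
def IsParent (G : SimpleGraph V) (r k j : V) : Prop :=
  G.Adj k j ∧ G.dist r k + 1 = G.dist r j

theorem exists_isParent {G : SimpleGraph V} (hG : G.Connected) {r j : V} (hj : j ≠ r) :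
    ∃ k, IsParent G r k j := by
  obtain ⟨p, hp⟩ := hG.exists_walk_length_eq_dist j r
  cases p with
  | nil => exact absurd rfl hj
  | @cons _ k _ h q =>
    refine ⟨k, h.symm, ?_⟩
    have h1 := G.dist_le q
    have h2 : G.dist j r ≤ G.dist j k + G.dist k r := hG.dist_triangle
    rw [SimpleGraph.dist_eq_one_iff_adj.2 h] at h2
    rw [SimpleGraph.Walk.length_cons] at hp
    rw [G.dist_comm (u := r), G.dist_comm (u := r)]
    omega

/-- Each parent of j is the second vertex of a geodesic from j to r, and a tree has only one path
between them. -/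
theorem IsParent.eq_of_isTree {T : SimpleGraph V} (hT : T.IsTree) {r j k k' : V}
    (h : IsParent T r k j) (h' : IsParent T r k' j) : k = k' := by
  have key : ∀ {k}, IsParent T r k j → ∃ p : T.Walk j r, p.IsPath ∧ p.snd = k := by
    intro k h
    obtain ⟨p, hp⟩ := hT.connected.exists_walk_length_eq_dist k r
    refine ⟨.cons h.1.symm p, ?_, by simp⟩
    apply SimpleGraph.Walk.isPath_of_length_eq_dist
    rw [SimpleGraph.Walk.length_cons, hp, T.dist_comm, h.2, T.dist_comm]
  obtain ⟨p, hp, rfl⟩ := key h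
  obtain ⟨q, hq, rfl⟩ := key h'
  rw [(hT.existsUnique_path j r).unique hp hq]

theorem isParent_or_isParent_of_adj {T : SimpleGraph V} (hT : T.IsTree) (r : V) {i j : V}
    (h : T.Adj i j) : IsParent T r i j ∨ IsParent T r j i := by
  rcases hT.dist_eq_dist_add_one_of_adj r h with h1 | h1
  · exact Or.inr ⟨h.symm, h1.symm⟩
  · exact Or.inl ⟨h, h1.symm⟩

theorem IsParent.ne_root {G : SimpleGraph V} {r k j : V} (h : IsParent G r k j) : j ≠ r := by
  rintro rfl
  simpa using h.2

variable [LinearOrder V]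

/-- `k` is the least parent of `j`. -/
def IsMinParent (G : SimpleGraph V) (r k j : V) : Prop :=
  IsParent G r k j ∧ ∀ i, IsParent G r i j → k ≤ i

theorem IsMinParent.unique {G : SimpleGraph V} {r j k k' : V} (h : IsMinParent G r k j)
    (h' : IsMinParent G r k' j) : k = k' :=
  le_antisymm (h.2 _ h'.1) (h'.2 _ h.1)

theorem exists_isMinParent [Fintype V] {G : SimpleGraph V} (hG : G.Connected) {r j : V}
    (hj : j ≠ r) : ∃ k, IsMinParent G r k j := by
  obtain ⟨k, hk⟩ := exists_isParent hG hj
  have hne : (Finset.univ.filter fun k => IsParent G r k j).Nonempty :=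
    ⟨k, by simpa using hk⟩
  refine ⟨_, by simpa using Finset.min'_mem _ hne, fun i hi => ?_⟩
  exact Finset.min'_le _ _ (by simpa using hi)

/-- The Penrose tree of a connected graph: every vertex other than the root is joined to its least
parent. -/
def penroseTree (G : SimpleGraph V) (r : V) : SimpleGraph V where
  Adj i j := IsMinParent G r i j ∨ IsMinParent G r j i
  symm.symm _ _ h := h.symm
  loopless.irrefl i h := G.loopless.irrefl i (by
    rcases h with h | h <;> exact h.1.1)

theorem penroseTree_le (G : SimpleGraph V) (r : V) : penroseTree G r ≤ G := by
  intro i j h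
  rcases h with h | h
  · exact h.1.1
  · exact h.1.1.symm

/-- Following least parents from j descends one generation at a time and reaches r in d steps. As
the Penrose tree lies in G, generations agree in both. -/
theorem penroseTree_reachable_and_dist_le [Fintype V] {G : SimpleGraph V} (hG : G.Connected)
    (r : V) (d : ℕ) : ∀ j, G.dist r j = d →
      (penroseTree G r).Reachable r j ∧ (penroseTree G r).dist r j ≤ d := by
  induction d with
  | zero =>
    intro j hj
    obtain rfl := hG.dist_eq_zero_iff.1 hj
    simp
  | succ d ih =>
    intro j hj
    have hne : j ≠ r := by
      rintro rfl
      simp at hj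
    obtain ⟨k, hk⟩ := exists_isMinParent hG hne
    have hadj : (penroseTree G r).Adj k j := Or.inl hk
    obtain ⟨h1, h2⟩ := ih k (by have := hk.1.2; omega)
    refine ⟨h1.trans hadj.reachable, ?_⟩
    have := h1.dist_triangle_left j
    rw [SimpleGraph.dist_eq_one_iff_adj.2 hadj] at this
    omega

theorem penroseTree_connected [Fintype V] {G : SimpleGraph V} (hG : G.Connected) (r : V) :
    (penroseTree G r).Connected :=
  (SimpleGraph.connected_iff_exists_forall_reachable _).2
    ⟨r, fun j => (penroseTree_reachable_and_dist_le hG r _ j rfl).1⟩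

theorem penroseTree_dist [Fintype V] {G : SimpleGraph V} (hG : G.Connected) (r j : V) :
    (penroseTree G r).dist r j = G.dist r j := by
  obtain ⟨h1, h2⟩ := penroseTree_reachable_and_dist_le hG r _ j rfl
  exact le_antisymm h2 (SimpleGraph.Reachable.dist_anti (penroseTree_le G r) h1)

theorem penroseTree_isTree [Fintype V] {G : SimpleGraph V} (hG : G.Connected) (r : V) :
    (penroseTree G r).IsTree := by
  have hconn := penroseTree_connected hG r
  refine SimpleGraph.isTree_iff_connected_and_card.2 ⟨hconn, ?_⟩
  refine le_antisymm ?_ hconn.card_vert_le_card_edgeSet_add_one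
  -- Every edge joins some non-root vertex to its least parent, so there are at most |V| - 1 edges.
  choose p hp using fun j : {j // j ≠ r} => exists_isMinParent hG j.2
  have hsurj : Function.Surjective fun j : {j // j ≠ r} =>
      (⟨s(p j, j.1), (penroseTree G r).mem_edgeSet.2 (Or.inl (hp j))⟩ :
        (penroseTree G r).edgeSet) := by
    rintro ⟨e, he⟩
    induction e using Sym2.ind with
    | _ i j =>
      rcases (penroseTree G r).mem_edgeSet.1 he with h | h
      · refine ⟨⟨j, h.1.ne_root⟩, Subtype.ext ?_⟩
        change s(p ⟨j, _⟩, j) = s(i, j)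
        rw [(hp ⟨j, h.1.ne_root⟩).unique h]
      · refine ⟨⟨i, h.1.ne_root⟩, Subtype.ext ?_⟩
        change s(p ⟨i, _⟩, i) = s(i, j)
        rw [(hp ⟨i, h.1.ne_root⟩).unique h]
        exact Sym2.eq_swap
  have h1 : Nat.card (penroseTree G r).edgeSet ≤ _ := Nat.card_le_card_of_surjective _ hsurj
  have h2 : Nat.card {j // j ≠ r} + 1 = Nat.card V := by
    rw [Nat.card_eq_fintype_card, Nat.card_eq_fintype_card, Fintype.card_subtype_compl,
      Fintype.card_subtype_eq]
    have := Fintype.card_pos_iff.2 ⟨r⟩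
    omega
  omega

/-- The edges outside of the tree `T` that can be added to `T` without changing the Penrose tree:
those within a generation, and those from `j` to a vertex of the previous generation that is larger
than a parent of `j`. -/
def penroseExtra (T : SimpleGraph V) (r : V) : SimpleGraph V :=
  SimpleGraph.fromRel fun i j => T.dist r i = T.dist r j ∨
    (T.dist r i + 1 = T.dist r j ∧ ∃ k, IsParent T r k j ∧ k < i)

theorem penroseExtra_adj {T : SimpleGraph V} {r i j : V} :
    (penroseExtra T r).Adj i j ↔ i ≠ j ∧ (T.dist r i = T.dist r j ∨
      (T.dist r i + 1 = T.dist r j ∧ ∃ k, IsParent T r k j ∧ k < i) ∨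
      (T.dist r j + 1 = T.dist r i ∧ ∃ k, IsParent T r k i ∧ k < j)) := by
  rw [penroseExtra, SimpleGraph.fromRel_adj]
  constructor
  · rintro ⟨h, (h1 | h1) | (h1 | h1)⟩ <;> simp [h, h1]
  · rintro ⟨h, h1 | h1 | h1⟩ <;> simp [h, h1]

theorem disjoint_penroseExtra {T : SimpleGraph V} (hT : T.IsTree) (r : V) {i j : V}
    (h : T.Adj i j) : ¬ (penroseExtra T r).Adj i j := by
  rw [penroseExtra_adj]
  rintro ⟨-, h1 | ⟨h1, k, hk, hlt⟩ | ⟨h1, k, hk, hlt⟩⟩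
  · exact hT.dist_ne_of_adj r h h1
  · exact hlt.ne (hk.eq_of_isTree hT ⟨h, h1⟩)
  · exact hlt.ne (hk.eq_of_isTree hT ⟨h.symm, h1⟩)

/-- An edge of G joins equal or consecutive generations. In the second case its upper end is a
parent in G, hence the least parent or larger than it. -/
theorem le_sup_penroseExtra [Fintype V] {G : SimpleGraph V} (hG : G.Connected) (r : V) :
    G ≤ penroseTree G r ⊔ penroseExtra (penroseTree G r) r := by
  have key : ∀ {i j}, G.Adj i j → G.dist r i + 1 = G.dist r j →
      ¬ (penroseTree G r).Adj i j → ∃ k, IsParent (penroseTree G r) r k j ∧ k < i := by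
    intro i j h h1 hn
    have hp : IsParent G r i j := ⟨h, h1⟩
    obtain ⟨k, hk⟩ := exists_isMinParent hG hp.ne_root
    refine ⟨k, ⟨Or.inl hk, ?_⟩, lt_of_le_of_ne (hk.2 i hp) ?_⟩
    · rw [penroseTree_dist hG, penroseTree_dist hG, hk.1.2]
    · rintro rfl
      exact hn (Or.inl hk)
  intro i j h
  rw [SimpleGraph.sup_adj]
  by_cases hn : (penroseTree G r).Adj i j
  · exact Or.inl hn
  · refine Or.inr (penroseExtra_adj.2 ⟨h.ne, ?_⟩)
    rw [penroseTree_dist hG, penroseTree_dist hG]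
    have h1 := hG.dist_triangle (u := r) (v := i) (w := j)
    have h2 := hG.dist_triangle (u := r) (v := j) (w := i)
    rw [SimpleGraph.dist_eq_one_iff_adj.2 h] at h1
    rw [SimpleGraph.dist_eq_one_iff_adj.2 h.symm] at h2
    rcases lt_trichotomy (G.dist r i) (G.dist r j) with h3 | h3 | h3
    · exact Or.inr (Or.inl ⟨by omega, key h (by omega) hn⟩)
    · exact Or.inl h3
    · exact Or.inr (Or.inr ⟨by omega, key h.symm (by omega) fun h' => hn h'.symm⟩)

/-- No edge of G changes the `T`-generation by more than one, so no walk in G is a shortcut. -/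
theorem dist_eq_of_le_sup_penroseExtra {T G : SimpleGraph V} (hT : T.IsTree) {r : V}
    (h1 : T ≤ G) (h2 : G ≤ T ⊔ penroseExtra T r) (j : V) : G.dist r j = T.dist r j := by
  have hG : G.Connected := hT.connected.mono h1
  refine le_antisymm (SimpleGraph.Reachable.dist_anti h1 (hT.connected r j)) ?_
  have hstep : ∀ {a b}, G.Adj a b → T.dist r b ≤ T.dist r a + 1 := by
    intro a b h
    rcases h2 h with h | h
    · have := hT.dist_eq_dist_add_one_of_adj r h
      omega
    · have := (penroseExtra_adj.1 h).2
      omega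
  have hwalk : ∀ {a b} (p : G.Walk a b), T.dist r b ≤ T.dist r a + p.length := by
    intro a b p
    induction p with
    | nil => simp
    | cons h q ih =>
      have := hstep h
      rw [SimpleGraph.Walk.length_cons]
      omega
  obtain ⟨p, hp⟩ := hG.exists_walk_length_eq_dist r j
  have := hwalk p
  rw [SimpleGraph.dist_self] at this
  omega

/-- Generations are those of `T`, and an extra edge only adds parents larger than the `T`-parent, so
the least parent is unchanged. -/
theorem penroseTree_eq_of_le [Fintype V] {T G : SimpleGraph V} (hT : T.IsTree) {r : V}
    (h1 : T ≤ G) (h2 : G ≤ T ⊔ penroseExtra T r) : penroseTree G r = T := by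
  have hd := dist_eq_of_le_sup_penroseExtra hT h1 h2
  have key : ∀ k j, IsMinParent G r k j ↔ IsParent T r k j := by
    have hle : ∀ {k j i}, IsParent T r k j → IsParent G r i j → k ≤ i := by
      rintro k j i hk ⟨hi1, hi2⟩
      rw [hd, hd] at hi2
      rcases h2 hi1 with h | h
      · exact (hk.eq_of_isTree hT ⟨h, hi2⟩).le
      · rcases (penroseExtra_adj.1 h).2 with h | ⟨-, k', hk', hlt⟩ | h
        · omega
        · rw [hk.eq_of_isTree hT hk']
          exact hlt.le
        · omega
    have hmono : ∀ {k j}, IsParent T r k j → IsParent G r k j := fun h =>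
      ⟨h1 h.1, by rw [hd, hd]; exact h.2⟩
    intro k j
    constructor
    · intro hk
      obtain ⟨i, hi⟩ := exists_isParent hT.connected hk.1.ne_root
      have := le_antisymm (hk.2 i (hmono hi)) (hle hi hk.1)
      rwa [this]
    · exact fun hk => ⟨hmono hk, fun i hi => hle hk hi⟩
  ext i j
  change IsMinParent G r i j ∨ IsMinParent G r j i ↔ _
  rw [key, key]
  constructor
  · rintro (h | h)
    · exact h.1
    · exact h.1.symm
  · exact isParent_or_isParent_of_adj hT r

variable [Fintype V]

/-- The edges of a graph, listed as pairs `i < j`. -/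
noncomputable def edgePairs (G : SimpleGraph V) : Finset (V × V) :=
  Finset.univ.filter fun p => p.1 < p.2 ∧ G.Adj p.1 p.2

theorem mem_edgePairs {G : SimpleGraph V} {p : V × V} :
    p ∈ edgePairs G ↔ p.1 < p.2 ∧ G.Adj p.1 p.2 := by
  simp [edgePairs]

theorem edgePairs_injective : Function.Injective (edgePairs (V := V)) := by
  intro G H h
  have key : ∀ {i j}, i < j → (G.Adj i j ↔ H.Adj i j) := by
    intro i j hij
    have := Finset.ext_iff.1 h (i, j)
    simpa [mem_edgePairs, hij] using this
  ext i j
  rcases lt_trichotomy i j with hij | rfl | hij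
  · exact key hij
  · simp
  · rw [G.adj_comm, H.adj_comm]
    exact key hij

/-- The graph whose edges are the pairs in `t`. -/
def graphOfPairs (t : Finset (V × V)) : SimpleGraph V :=
  SimpleGraph.fromRel fun i j => (i, j) ∈ t

theorem edgePairs_graphOfPairs {t : Finset (V × V)} (ht : ∀ p ∈ t, p.1 < p.2) :
    edgePairs (graphOfPairs t) = t := by
  ext ⟨i, j⟩
  rw [mem_edgePairs, graphOfPairs, SimpleGraph.fromRel_adj]
  constructor
  · rintro ⟨h1, -, h | h⟩
    · exact h
    · exact absurd (ht _ h) h1.asymm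
  · exact fun h => ⟨ht _ h, (ht _ h).ne, Or.inl h⟩

theorem edgePairs_sup (G H : SimpleGraph V) :
    edgePairs (G ⊔ H) = edgePairs G ∪ edgePairs H := by
  ext p
  simp only [mem_edgePairs, Finset.mem_union, SimpleGraph.sup_adj]
  tauto

theorem edgePairs_subset_iff {G H : SimpleGraph V} : edgePairs G ⊆ edgePairs H ↔ G ≤ H := by
  rw [← Finset.union_eq_right, ← edgePairs_sup, edgePairs_injective.eq_iff, sup_eq_right]

/-- A graph in the interval is a free choice of a subset of the edges of A; expand the product of 1
+ f over these subsets. -/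
theorem sum_interval_prod_edgePairs {R : Type*} [CommRing R] (f : V × V → R)
    (T A : SimpleGraph V) (h : Disjoint (edgePairs T) (edgePairs A)) :
    ∑ G : SimpleGraph V with T ≤ G ∧ G ≤ T ⊔ A, ∏ p ∈ edgePairs G, f p =
      (∏ p ∈ edgePairs T, f p) * ∏ p ∈ edgePairs A, (1 + f p) := by
  rw [Finset.prod_one_add, Finset.mul_sum]
  symm
  have hlt : ∀ t ∈ (edgePairs A).powerset, ∀ p ∈ t, p.1 < p.2 := fun t ht p hp =>
    (mem_edgePairs.1 (Finset.mem_powerset.1 ht hp)).1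
  refine Finset.sum_bij' (fun t _ => T ⊔ graphOfPairs t)
    (fun G _ => edgePairs G \ edgePairs T) ?_ ?_ ?_ ?_ ?_
  · intro t ht
    simp only [Finset.mem_filter, Finset.mem_univ, true_and]
    refine ⟨le_sup_left, sup_le_sup_left ?_ T⟩
    rw [← edgePairs_subset_iff, edgePairs_graphOfPairs (hlt t ht)]
    exact Finset.mem_powerset.1 ht
  · intro G hG
    simp only [Finset.mem_filter, Finset.mem_univ, true_and] at hG
    have h2 := edgePairs_subset_iff.2 hG.2
    rw [edgePairs_sup] at h2
    rw [Finset.mem_powerset]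
    exact sdiff_le_iff.2 h2
  · intro t ht
    rw [edgePairs_sup, edgePairs_graphOfPairs (hlt t ht), Finset.union_sdiff_left]
    exact Finset.sdiff_eq_self_of_disjoint
      (h.mono_right (Finset.mem_powerset.1 ht)).symm
  · intro G hG
    simp only [Finset.mem_filter, Finset.mem_univ, true_and] at hG
    apply edgePairs_injective
    rw [edgePairs_sup, edgePairs_graphOfPairs fun p hp =>
      (mem_edgePairs.1 (Finset.sdiff_subset hp)).1]
    exact Finset.union_sdiff_of_subset (edgePairs_subset_iff.2 hG.1)
  · intro t ht
    rw [edgePairs_sup, edgePairs_graphOfPairs (hlt t ht),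
      Finset.prod_union (h.mono_right (Finset.mem_powerset.1 ht))]

/-- Penrose's tree-graph identity. -/
theorem sum_connected_eq_sum_isTree {R : Type*} [CommRing R] (f : V × V → R) (r : V) :
    ∑ G : SimpleGraph V with G.Connected, ∏ p ∈ edgePairs G, f p =
      ∑ T : SimpleGraph V with T.IsTree, (∏ p ∈ edgePairs T, f p) *
        ∏ p ∈ edgePairs (penroseExtra T r), (1 + f p) := by
  -- Group the connected graphs by Penrose tree; each fibre is an interval.
  rw [← Finset.sum_fiberwise_of_maps_to (s := Finset.univ.filter SimpleGraph.Connected)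
    (t := Finset.univ.filter SimpleGraph.IsTree) (g := fun G => penroseTree G r)
    (fun G hG => by
      simp only [Finset.mem_filter, Finset.mem_univ, true_and] at hG ⊢
      exact penroseTree_isTree hG r)]
  refine Finset.sum_congr rfl fun T hT => ?_
  simp only [Finset.mem_filter, Finset.mem_univ, true_and] at hT
  rw [← sum_interval_prod_edgePairs f T _ ?_]
  · refine Finset.sum_congr ?_ fun _ _ => rfl
    ext G
    simp only [Finset.mem_filter, Finset.mem_univ, true_and]
    constructor
    · rintro ⟨hG, rfl⟩
      exact ⟨penroseTree_le G r, le_sup_penroseExtra hG r⟩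
    · rintro ⟨h1, h2⟩
      exact ⟨hT.connected.mono h1, penroseTree_eq_of_le hT h1 h2⟩
  · rw [Finset.disjoint_left]
    intro p hp hp'
    exact disjoint_penroseExtra hT r (mem_edgePairs.1 hp).2 (mem_edgePairs.1 hp').2

end Penrose

/-! ### The tree bound on ω^T -/

section TreeBound

open Classical

theorem enorm_finset_prod {ι : Type*} (s : Finset ι) (f : ι → ℂ) :
    ‖∏ i ∈ s, f i‖ₑ = ∏ i ∈ s, ‖f i‖ₑ := by
  simp only [enorm_eq_nnnorm, nnnorm_prod, ENNReal.ofNNReal_finsetProd]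

variable {S : Type*}

theorem omegaT_eq_sum_edgePairs (w : S → S → ℂ) {n : ℕ} (x : Fin n → S) :
    omegaT w x = ∑ G : SimpleGraph (Fin n) with G.Connected,
      ∏ p ∈ edgePairs G, (w (x p.1) (x p.2) - 1) := rfl

theorem mem_children {n : ℕ} {T : SimpleGraph (Fin (n + 1))} {i j : Fin (n + 1)} :
    j ∈ children T i ↔ IsParent T 0 i j := by
  simp [children, IsParent, eq_comm]

/-- Each tree edge is a parent-child pair in exactly one direction; symmetry of g allows its ends to
be sorted. -/
theorem prod_children {n : ℕ} {T : SimpleGraph (Fin (n + 1))} (hT : T.IsTree)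
    (g : Fin (n + 1) → Fin (n + 1) → ℝ≥0∞) (hg : ∀ i j, g i j = g j i) :
    ∏ i, ∏ j ∈ children T i, g i j = ∏ p ∈ edgePairs T, g p.1 p.2 := by
  rw [Finset.prod_sigma']
  have hasymm : ∀ {i j}, IsParent T 0 i j → ¬ IsParent T 0 j i := fun h h' => by
    have := h.2
    have := h'.2
    omega
  refine Finset.prod_bij' (fun s _ => if s.1 < s.2 then (s.1, s.2) else (s.2, s.1))
    (fun p _ => if IsParent T 0 p.1 p.2 then ⟨p.1, p.2⟩ else ⟨p.2, p.1⟩) ?_ ?_ ?_ ?_ ?_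
  · rintro ⟨i, j⟩ h
    have h : IsParent T 0 i j := by simpa [mem_children] using h
    rw [mem_edgePairs]
    dsimp only
    split_ifs with hij
    · exact ⟨hij, h.1⟩
    · exact ⟨lt_of_le_of_ne (not_lt.1 hij) h.1.ne', h.1.symm⟩
  · rintro ⟨i, j⟩ h
    have h := (mem_edgePairs.1 h).2
    simp only [Finset.mem_sigma, Finset.mem_univ, true_and, mem_children]
    split_ifs with hp
    · exact hp
    · exact (isParent_or_isParent_of_adj hT 0 h).resolve_left hp
  · rintro ⟨i, j⟩ h
    have h : IsParent T 0 i j := by simpa [mem_children] using h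
    by_cases hij : i < j
    · simp [hij, h]
    · simp [hij, hasymm h]
  · rintro ⟨i, j⟩ h
    obtain ⟨hlt, h⟩ := mem_edgePairs.1 h
    dsimp only at hlt h
    by_cases hp : IsParent T 0 i j
    · simp [hp, hlt]
    · simp [hp, hlt.asymm]
  · rintro ⟨i, j⟩ h
    by_cases hij : i < j
    · simp [hij]
    · simp [hij, hg i j]

/-- Siblings share a generation, so sibling pairs are extra edges, and no pair has two parents in
common. The other factors are at most 1. -/
theorem prod_penroseExtra_le {n : ℕ} {T : SimpleGraph (Fin (n + 1))} (hT : T.IsTree)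
    (g : Fin (n + 1) × Fin (n + 1) → ℝ≥0∞) (hg : ∀ p, g p ≤ 1) :
    ∏ p ∈ edgePairs (penroseExtra T 0), g p ≤
      ∏ i, ∏ p ∈ children T i ×ˢ children T i with p.1 < p.2, g p := by
  rw [← Finset.prod_biUnion]
  · refine Finset.prod_le_prod_of_subset_of_le_one' ?_ fun p _ _ => hg p
    intro p hp
    simp only [Finset.mem_biUnion, Finset.mem_univ, true_and, Finset.mem_filter,
      Finset.mem_product, mem_children] at hp
    obtain ⟨i, ⟨h1, h2⟩, h3⟩ := hp
    exact mem_edgePairs.2 ⟨h3, penroseExtra_adj.2 ⟨h3.ne, Or.inl (h1.2.symm.trans h2.2)⟩⟩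
  · intro i _ j _ hij
    rw [Function.onFun, Finset.disjoint_left]
    intro p hp hp'
    simp only [Finset.mem_filter, Finset.mem_product, mem_children] at hp hp'
    exact hij (hp.1.1.eq_of_isTree hT hp'.1.1)

/-- The tree-graph bound for `|w| ≤ 1`. -/
theorem enorm_omegaT_le_treeWeight {w : S → S → ℂ} (hw_symm : ∀ x y, w x y = w y x)
    (hw_le : ∀ x y, ‖w x y‖ ≤ 1) {n : ℕ} (x : Fin (n + 1) → S) :
    ‖omegaT w x‖ₑ ≤ treeWeight w x := by
  rw [omegaT_eq_sum_edgePairs,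
    sum_connected_eq_sum_isTree (fun p => w (x p.1) (x p.2) - 1) 0, treeWeight]
  refine (enorm_sum_le _ _).trans (Finset.sum_le_sum fun T hT => ?_)
  simp only [Finset.mem_filter, Finset.mem_univ, true_and] at hT
  simp only [add_sub_cancel, phi]
  rw [Finset.prod_mul_distrib, enorm_mul, enorm_finset_prod, enorm_finset_prod,
    prod_children hT (fun i j => ‖w (x i) (x j) - 1‖ₑ) fun i j => by rw [hw_symm]]
  gcongr
  refine prod_penroseExtra_le hT (fun p => ‖w (x p.1) (x p.2)‖ₑ) fun p => ?_
  simpa [enorm_eq_nnnorm, ← NNReal.coe_le_coe] using hw_le _ _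

end TreeBound

/-! ### Sums over graphs and their connected components -/

section GraphSum

open Classical

variable {R : Type*} [CommRing R] {ι κ : Type*} [LinearOrder ι] [Fintype ι] [LinearOrder κ]
  [Fintype κ]

/-- The sum over all graphs of the product of the edge weights. -/
noncomputable def graphSum (f : ι × ι → R) : R :=
  ∑ G : SimpleGraph ι, ∏ p ∈ edgePairs G, f p

/-- The sum over the connected graphs of the product of the edge weights. -/
noncomputable def connectedSum (f : ι × ι → R) : R :=
  ∑ G : SimpleGraph ι with G.Connected, ∏ p ∈ edgePairs G, f p

theorem graphSum_eq_prod (f : ι × ι → R) :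
    graphSum f = ∏ p : ι × ι with p.1 < p.2, (1 + f p) := by
  have h := sum_interval_prod_edgePairs f ⊥ ⊤ (by
    rw [Finset.disjoint_left]
    intro p hp
    simp [mem_edgePairs] at hp)
  have h1 : edgePairs (⊥ : SimpleGraph ι) = ∅ := by
    ext p
    simp [mem_edgePairs]
  have h2 : edgePairs (⊤ : SimpleGraph ι) = Finset.univ.filter fun p => p.1 < p.2 := by
    ext p
    simpa [mem_edgePairs] using fun h => ne_of_lt h
  rw [h1, h2] at h
  simpa [graphSum] using h

theorem prod_edgePairs_comap (e : κ ≃o ι) (f : ι × ι → R) (G : SimpleGraph ι) :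
    ∏ p ∈ edgePairs (G.comap e), f (e p.1, e p.2) = ∏ p ∈ edgePairs G, f p := by
  refine Finset.prod_nbij' (fun p => (e p.1, e p.2)) (fun p => (e.symm p.1, e.symm p.2))
    ?_ ?_ ?_ ?_ ?_ <;> simp [mem_edgePairs]

theorem comap_orderIso_bijective {α β : Type*} [LinearOrder α] [LinearOrder β] (e : α ≃o β) :
    Function.Bijective fun G : SimpleGraph β => G.comap e := by
  refine Function.bijective_iff_has_inverse.2 ⟨fun G => G.comap e.symm, fun G => ?_, fun G => ?_⟩
  · ext
    simp
  · ext
    simp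

theorem graphSum_comp_orderIso (e : κ ≃o ι) (f : ι × ι → R) :
    graphSum (fun p : κ × κ => f (e p.1, e p.2)) = graphSum f :=
  ((comap_orderIso_bijective e).sum_comp
    fun G => ∏ p ∈ edgePairs G, f (e p.1, e p.2)).symm.trans
    (Finset.sum_congr rfl fun G _ => prod_edgePairs_comap e f G)

theorem connectedSum_comp_orderIso (e : κ ≃o ι) (f : ι × ι → R) :
    connectedSum (fun p : κ × κ => f (e p.1, e p.2)) = connectedSum f := by
  rw [connectedSum, connectedSum, Finset.sum_filter, Finset.sum_filter]
  refine ((comap_orderIso_bijective e).sum_comp fun G => if G.Connected then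
    ∏ p ∈ edgePairs G, f (e p.1, e p.2) else 0).symm.trans
    (Finset.sum_congr rfl fun G _ => ?_)
  have hiso : (G.comap e).Connected ↔ G.Connected :=
    (SimpleGraph.Iso.comap e.toEquiv G).connected_iff
  simp only [hiso, prod_edgePairs_comap]

/-- The edge product factorizes if `V` is a union of connected components of `G`. -/
theorem prod_edgePairs_split (f : ι × ι → R) {G : SimpleGraph ι} {V : Finset ι}
    (hV : ∀ i j, G.Adj i j → (i ∈ V ↔ j ∈ V)) :
    ∏ p ∈ edgePairs G, f p =
      (∏ p ∈ edgePairs (G.comap (Subtype.val : {i // i ∈ V} → ι)), f (p.1.1, p.2.1)) *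
        ∏ p ∈ edgePairs (G.comap (Subtype.val : {i // i ∉ V} → ι)), f (p.1.1, p.2.1) := by
  rw [← Finset.prod_filter_mul_prod_filter_not (edgePairs G) fun p => p.1 ∈ V]
  congr 1
  · symm
    refine Finset.prod_bij (fun p _ => (p.1.1, p.2.1)) ?_ ?_ ?_ ?_
    · rintro ⟨⟨i, hi⟩, ⟨j, hj⟩⟩ h
      simpa [mem_edgePairs, hi] using h
    · rintro ⟨⟨i, hi⟩, ⟨j, hj⟩⟩ _ ⟨⟨i', hi'⟩, ⟨j', hj'⟩⟩ _ h
      simpa using h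
    · rintro ⟨i, j⟩ h
      simp only [Finset.mem_filter, mem_edgePairs] at h
      exact ⟨(⟨i, h.2⟩, ⟨j, (hV _ _ h.1.2).1 h.2⟩), by simpa [mem_edgePairs] using h.1, rfl⟩
    · simp
  · symm
    refine Finset.prod_bij (fun p _ => (p.1.1, p.2.1)) ?_ ?_ ?_ ?_
    · rintro ⟨⟨i, hi⟩, ⟨j, hj⟩⟩ h
      simpa [mem_edgePairs, hi] using h
    · rintro ⟨⟨i, hi⟩, ⟨j, hj⟩⟩ _ ⟨⟨i', hi'⟩, ⟨j', hj'⟩⟩ _ h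
      simpa using h
    · rintro ⟨i, j⟩ h
      simp only [Finset.mem_filter, mem_edgePairs] at h
      exact ⟨(⟨i, h.2⟩, ⟨j, fun hj => h.2 ((hV _ _ h.1.2).2 hj)⟩),
        by simpa [mem_edgePairs] using h.1, rfl⟩
    · simp

/-- A graph in which V is the component of r is a connected graph on V together with an arbitrary
graph on the complement. -/
theorem sum_component_eq (f : ι × ι → R) (r : ι) {V : Finset ι} (hr : r ∈ V) :
    ∑ G : SimpleGraph ι with (∀ i, G.Reachable r i ↔ i ∈ V), ∏ p ∈ edgePairs G, f p =
      connectedSum (fun p : {i // i ∈ V} × {i // i ∈ V} => f (p.1.1, p.2.1)) *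
        graphSum (fun p : {i // i ∉ V} × {i // i ∉ V} => f (p.1.1, p.2.1)) := by
  rw [connectedSum, graphSum, Finset.sum_mul_sum, ← Finset.sum_product']
  have hclosed : ∀ {G : SimpleGraph ι}, (∀ i, G.Reachable r i ↔ i ∈ V) →
      ∀ i j, G.Adj i j → (i ∈ V ↔ j ∈ V) := by
    intro G hG i j h
    rw [← hG, ← hG]
    exact ⟨fun h' => h'.trans h.reachable, fun h' => h'.trans h.symm.reachable⟩
  set join : SimpleGraph {i // i ∈ V} × SimpleGraph {i // i ∉ V} → SimpleGraph ι := fun q =>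
    q.1.map (Function.Embedding.subtype _) ⊔ q.2.map (Function.Embedding.subtype _) with hjoin
  have hadj : ∀ q i j, (join q).Adj i j ↔
      (∃ hi : i ∈ V, ∃ hj : j ∈ V, q.1.Adj ⟨i, hi⟩ ⟨j, hj⟩) ∨
      (∃ hi : i ∉ V, ∃ hj : j ∉ V, q.2.Adj ⟨i, hi⟩ ⟨j, hj⟩) := by
    rintro ⟨G, H⟩ i j
    simp only [hjoin, SimpleGraph.sup_adj, SimpleGraph.map_adj]
    constructor
    · rintro (⟨⟨u, hu⟩, ⟨v, hv⟩, h, rfl, rfl⟩ | ⟨⟨u, hu⟩, ⟨v, hv⟩, h, rfl, rfl⟩)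
      · exact Or.inl ⟨hu, hv, h⟩
      · exact Or.inr ⟨hu, hv, h⟩
    · rintro (⟨hu, hv, h⟩ | ⟨hu, hv, h⟩)
      · exact Or.inl ⟨_, _, h, rfl, rfl⟩
      · exact Or.inr ⟨_, _, h, rfl, rfl⟩
  have hjoinclosed : ∀ q i j, (join q).Adj i j → (i ∈ V ↔ j ∈ V) := by
    intro q i j h
    rcases (hadj q i j).1 h with ⟨hi, hj, -⟩ | ⟨hi, hj, -⟩
    · exact iff_of_true hi hj
    · exact iff_of_false hi hj
  refine Finset.sum_bij' (fun G _ => (G.comap Subtype.val, G.comap Subtype.val))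
    (fun q _ => join q) ?_ ?_ ?_ ?_ ?_
  · intro G hG
    simp only [Finset.mem_filter, Finset.mem_univ, true_and] at hG
    simp only [Finset.mem_product, Finset.mem_filter, Finset.mem_univ, true_and, and_true]
    have hwalk : ∀ {a b} (p : G.Walk a b) (ha : a ∈ V), ∃ hb : b ∈ V,
        (G.comap (Subtype.val : {i // i ∈ V} → ι)).Reachable ⟨a, ha⟩ ⟨b, hb⟩ := by
      intro a b p
      induction p with
      | nil => exact fun ha => ⟨ha, .refl _⟩
      | @cons a c b h q ih =>
        intro ha
        have hc := (hclosed hG _ _ h).1 ha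
        obtain ⟨hb, hr⟩ := ih hc
        refine ⟨hb, .trans (SimpleGraph.Adj.reachable ?_) hr⟩
        simpa using h
    refine (SimpleGraph.connected_iff_exists_forall_reachable _).2 ⟨⟨r, hr⟩, fun i => ?_⟩
    obtain ⟨p⟩ := (hG i.1).2 i.2
    exact (hwalk p hr).2
  · rintro ⟨G, H⟩ hq
    simp only [Finset.mem_product, Finset.mem_filter, Finset.mem_univ, true_and, and_true] at hq ⊢
    intro i
    constructor
    · rintro ⟨p⟩
      have : ∀ {a b} (p : (join (G, H)).Walk a b), a ∈ V → b ∈ V := by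
        intro a b p
        induction p with
        | nil => exact id
        | cons h q ih => exact fun ha => ih ((hjoinclosed _ _ _ h).1 ha)
      exact this p hr
    · intro hi
      have h1 := (hq.preconnected ⟨r, hr⟩ ⟨i, hi⟩).map
        (⟨Subtype.val, fun {a b} h => (hadj (G, H) a b).2 (Or.inl ⟨a.2, b.2, h⟩)⟩ :
          G →g join (G, H))
      exact h1
  · intro G hG
    simp only [Finset.mem_filter, Finset.mem_univ, true_and] at hG
    ext i j
    rw [hadj]
    simp only [SimpleGraph.comap_adj]
    constructor
    · rintro (⟨-, -, h⟩ | ⟨-, -, h⟩) <;> exact h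
    · intro h
      by_cases hi : i ∈ V
      · exact Or.inl ⟨hi, (hclosed hG _ _ h).1 hi, h⟩
      · exact Or.inr ⟨hi, fun hj => hi ((hclosed hG _ _ h).2 hj), h⟩
  · rintro ⟨G, H⟩ hq
    refine Prod.ext ?_ ?_
    · ext ⟨i, hi⟩ ⟨j, hj⟩
      rw [SimpleGraph.comap_adj, hadj]
      simp [hi, hj]
    · ext ⟨i, hi⟩ ⟨j, hj⟩
      rw [SimpleGraph.comap_adj, hadj]
      simp [hi, hj]
  · intro G hG
    simp only [Finset.mem_filter, Finset.mem_univ, true_and] at hG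
    exact prod_edgePairs_split f (hclosed hG)

/-- Decomposition of the graphs according to the connected component of the vertex `r`. -/
theorem graphSum_eq_sum_component (f : ι × ι → R) (r : ι) :
    graphSum f = ∑ V : Finset ι with r ∈ V,
      connectedSum (fun p : {i // i ∈ V} × {i // i ∈ V} => f (p.1.1, p.2.1)) *
        graphSum (fun p : {i // i ∉ V} × {i // i ∉ V} => f (p.1.1, p.2.1)) := by
  rw [graphSum, ← Finset.sum_fiberwise_of_maps_to (s := Finset.univ)
    (t := Finset.univ.filter fun V : Finset ι => r ∈ V)
    (g := fun G : SimpleGraph ι => Finset.univ.filter fun i => G.Reachable r i)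
    (fun G _ => by simp)]
  refine Finset.sum_congr rfl fun V hV => ?_
  rw [← sum_component_eq f r (by simpa using hV)]
  refine Finset.sum_congr ?_ fun _ _ => rfl
  ext G
  simp [Finset.ext_iff]

end GraphSum

/-! ### Integrals of ω and ω^T, and their recursion -/

section ClusterIntegral

open Classical

variable {S : Type*} {ι κ : Type*} [LinearOrder ι] [Fintype ι] [LinearOrder κ] [Fintype κ]

/-- The edge weight `w(x_i,x_j) - 1`. -/
def pairWeight (w : S → S → ℂ) (x : ι → S) (p : ι × ι) : ℂ := w (x p.1) (x p.2) - 1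

theorem omega_eq_graphSum (w : S → S → ℂ) {n : ℕ} (x : Fin n → S) :
    omega w x = graphSum (pairWeight w x) := by
  rw [graphSum_eq_prod]
  simp [omega, pairWeight]

theorem norm_prod_pairWeight_le {α : Type*} {w : S → S → ℂ} (hw_le : ∀ x y, ‖w x y‖ ≤ 1)
    (s : Finset (α × α)) (x : α → S) : ‖∏ p ∈ s, pairWeight w x p‖ ≤ 2 ^ s.card := by
  rw [norm_prod, ← Finset.prod_const]
  refine Finset.prod_le_prod (fun _ _ => norm_nonneg _) fun p _ => (norm_sub_le _ _).trans ?_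
  rw [norm_one]
  linarith [hw_le (x p.1) (x p.2)]

variable [MeasurableSpace S]

theorem measurable_prod_pairWeight {α : Type*} {w : S → S → ℂ} (hw : Measurable (Function.uncurry w))
    (s : Finset (α × α)) :
    Measurable fun x : α → S => ∏ p ∈ s, pairWeight w x p := by
  refine Finset.measurable_prod _ fun p _ => Measurable.sub_const ?_ _
  have h : Measurable fun x : α → S => (x p.1, x p.2) :=
    (measurable_pi_apply p.1).prodMk (measurable_pi_apply p.2)
  exact hw.comp h

theorem measurable_connectedSum {w : S → S → ℂ} (hw : Measurable (Function.uncurry w)) :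
    Measurable fun x : ι → S => connectedSum (pairWeight w x) :=
  Finset.measurable_sum _ fun _ _ => measurable_prod_pairWeight hw _

/-- `∫ ω(x) ∏ ξ(x_i) μ(dx)`. -/
noncomputable def graphIntegral (ι : Type*) [LinearOrder ι] [Fintype ι] (w : S → S → ℂ)
    (μ : Measure S) (ξ : S → ℂ) : ℂ :=
  ∫ x : ι → S, graphSum (pairWeight w x) * ∏ i, ξ (x i) ∂(Measure.pi fun _ => μ)

/-- `∫ ω^T(x) ∏ ξ(x_i) μ(dx)`. -/
noncomputable def connectedIntegral (ι : Type*) [LinearOrder ι] [Fintype ι] (w : S → S → ℂ)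
    (μ : Measure S) (ξ : S → ℂ) : ℂ :=
  ∫ x : ι → S, connectedSum (pairWeight w x) * ∏ i, ξ (x i) ∂(Measure.pi fun _ => μ)

variable {w : S → S → ℂ} {μ : Measure S} [SigmaFinite μ] {ξ : S → ℂ}

theorem integrable_sum_graphs (hw : Measurable (Function.uncurry w))
    (hw_le : ∀ x y, ‖w x y‖ ≤ 1) (hξ : Integrable ξ μ) (s : Finset (SimpleGraph ι)) :
    Integrable (fun x : ι → S => (∑ G ∈ s, ∏ p ∈ edgePairs G, pairWeight w x p) * ∏ i, ξ (x i))
      (Measure.pi fun _ => μ) := by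
  simp only [Finset.sum_mul]
  refine integrable_finsetSum _ fun G _ => ?_
  exact (Integrable.fintype_prod fun _ => hξ).bdd_mul
    (measurable_prod_pairWeight hw _).aestronglyMeasurable
    (Filter.Eventually.of_forall fun x => norm_prod_pairWeight_le hw_le _ x)

theorem pairWeight_piCongrLeft {α β : Type*} [LinearOrder α] [LinearOrder β] (e : β ≃o α)
    (x : β → S) :
    (fun p : β × β => pairWeight w
      (MeasurableEquiv.piCongrLeft (fun _ : α => S) e.toEquiv x) (e p.1, e p.2)) =
      pairWeight w x := by
  funext p
  have h : ∀ k, MeasurableEquiv.piCongrLeft (fun _ : α => S) e.toEquiv x (e k) = x k := fun k =>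
    Equiv.piCongrLeft_apply_apply (fun _ : α => S) e.toEquiv x k
  simp only [pairWeight, h]

theorem prod_piCongrLeft (e : κ ≃o ι) (x : κ → S) :
    ∏ i, ξ (MeasurableEquiv.piCongrLeft (fun _ : ι => S) e.toEquiv x i) = ∏ k, ξ (x k) := by
  rw [← e.toEquiv.prod_comp]
  refine Finset.prod_congr rfl fun k _ => ?_
  exact congrArg ξ (Equiv.piCongrLeft_apply_apply (fun _ : ι => S) e.toEquiv x k)

theorem graphIntegral_congr (e : κ ≃o ι) :
    graphIntegral κ w μ ξ = graphIntegral ι w μ ξ := by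
  rw [graphIntegral, graphIntegral,
    ← (measurePreserving_piCongrLeft (fun _ : ι => μ) e.toEquiv).integral_comp']
  refine integral_congr_ae (Filter.Eventually.of_forall fun x => ?_)
  simp only
  rw [prod_piCongrLeft, ← graphSum_comp_orderIso e, pairWeight_piCongrLeft]

theorem connectedIntegral_congr (e : κ ≃o ι) :
    connectedIntegral κ w μ ξ = connectedIntegral ι w μ ξ := by
  rw [connectedIntegral, connectedIntegral,
    ← (measurePreserving_piCongrLeft (fun _ : ι => μ) e.toEquiv).integral_comp']
  refine integral_congr_ae (Filter.Eventually.of_forall fun x => ?_)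
  simp only
  rw [prod_piCongrLeft, ← connectedSum_comp_orderIso e, pairWeight_piCongrLeft]

theorem graphIntegral_eq_fin {n : ℕ} (h : Fintype.card ι = n) :
    graphIntegral ι w μ ξ = graphIntegral (Fin n) w μ ξ :=
  (graphIntegral_congr (Fintype.orderIsoFinOfCardEq ι h)).symm

theorem connectedIntegral_eq_fin {n : ℕ} (h : Fintype.card ι = n) :
    connectedIntegral ι w μ ξ = connectedIntegral (Fin n) w μ ξ :=
  (connectedIntegral_congr (Fintype.orderIsoFinOfCardEq ι h)).symm

/-- The component decomposition holds pointwise, and each summand factorizes over the coordinates in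
V and outside it; Fubini does the rest. -/
theorem graphIntegral_eq_sum_component (hw : Measurable (Function.uncurry w))
    (hw_le : ∀ x y, ‖w x y‖ ≤ 1) (hξ : Integrable ξ μ) (r : ι) :
    graphIntegral ι w μ ξ = ∑ V : Finset ι with r ∈ V,
      connectedIntegral {i // i ∈ V} w μ ξ * graphIntegral {i // i ∉ V} w μ ξ := by
  let g : ∀ V : Finset ι, ({i // i ∈ V} → S) × ({i // i ∉ V} → S) → ℂ := fun V z =>
    (connectedSum (pairWeight w z.1) * ∏ i, ξ (z.1 i)) *
      (graphSum (pairWeight w z.2) * ∏ i, ξ (z.2 i))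
  have hmp : ∀ V : Finset ι, MeasurePreserving
      (MeasurableEquiv.piEquivPiSubtypeProd (fun _ => S) (fun i => i ∈ V))
      (Measure.pi fun _ : ι => μ) ((Measure.pi fun _ : {i // i ∈ V} => μ).prod
      (Measure.pi fun _ : {i // i ∉ V} => μ)) := fun V => by
    convert measurePreserving_piEquivPiSubtypeProd (fun _ : ι => μ) (fun i => i ∈ V)
  have hg : ∀ V, Integrable (g V) ((Measure.pi fun _ : {i // i ∈ V} => μ).prod
      (Measure.pi fun _ : {i // i ∉ V} => μ)) := fun V =>
    (integrable_sum_graphs (ι := {i // i ∈ V}) hw hw_le hξ _).mul_prod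
      (integrable_sum_graphs (ι := {i // i ∉ V}) hw hw_le hξ Finset.univ)
  have hint : ∀ V, Integrable (fun x : ι → S =>
      g V (MeasurableEquiv.piEquivPiSubtypeProd (fun _ => S) (fun i => i ∈ V) x))
      (Measure.pi fun _ => μ) := fun V =>
    (hmp V).integrable_comp_of_integrable (hg V)
  have hsplit : ∀ x : ι → S, graphSum (pairWeight w x) * ∏ i, ξ (x i) =
      ∑ V : Finset ι with r ∈ V,
        g V (MeasurableEquiv.piEquivPiSubtypeProd (fun _ => S) (fun i => i ∈ V) x) := by
    intro x
    rw [graphSum_eq_sum_component _ r, Finset.sum_mul]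
    refine Finset.sum_congr rfl fun V _ => ?_
    have h : ∏ i, ξ (x i) = (∏ i : {i // i ∈ V}, ξ (x i)) * ∏ i : {i // i ∉ V}, ξ (x i) := by
      convert (Fintype.prod_subtype_mul_prod_subtype (fun i => i ∈ V) fun i => ξ (x i)).symm
    rw [h, mul_mul_mul_comm]
    rfl
  rw [graphIntegral]
  simp only [hsplit]
  rw [integral_finsetSum _ fun V _ => hint V]
  refine Finset.sum_congr rfl fun V _ => ?_
  rw [(hmp V).integral_comp' (g := g V)]
  exact integral_prod_mul (L := ℂ) (μ := Measure.pi fun _ : {i // i ∈ V} => μ)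
    (ν := Measure.pi fun _ : {i // i ∉ V} => μ)
    (fun y => connectedSum (pairWeight w y) * ∏ i, ξ (y i))
    (fun y => graphSum (pairWeight w y) * ∏ i, ξ (y i))

theorem graphIntegral_fin_succ (hw : Measurable (Function.uncurry w))
    (hw_le : ∀ x y, ‖w x y‖ ≤ 1) (hξ : Integrable ξ μ) (n : ℕ) :
    graphIntegral (Fin (n + 1)) w μ ξ = ∑ k ∈ Finset.range (n + 1), (n.choose k : ℂ) *
      (connectedIntegral (Fin (k + 1)) w μ ξ * graphIntegral (Fin (n - k)) w μ ξ) := by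
  rw [graphIntegral_eq_sum_component hw hw_le hξ 0]
  set F : ℕ → ℂ := fun k =>
    connectedIntegral (Fin (k + 1)) w μ ξ * graphIntegral (Fin (n - k)) w μ ξ with hF
  have h1 : ∑ V : Finset (Fin (n + 1)) with 0 ∈ V,
      connectedIntegral {i // i ∈ V} w μ ξ * graphIntegral {i // i ∉ V} w μ ξ =
      ∑ U ∈ (Finset.univ.erase (0 : Fin (n + 1))).powerset, F U.card := by
    refine Finset.sum_bij' (fun V _ => V.erase 0) (fun U _ => insert 0 U) ?_ ?_ ?_ ?_ ?_
    · intro V _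
      rw [Finset.mem_powerset]
      exact Finset.erase_subset_erase _ (Finset.subset_univ _)
    · simp
    · intro V hV
      exact Finset.insert_erase (by simpa using hV)
    · intro U hU
      refine Finset.erase_insert fun h => ?_
      simpa using Finset.mem_powerset.1 hU h
    · intro V hV
      have h0 : 0 ∈ V := by simpa using hV
      have hc := Finset.card_erase_add_one h0
      have h2 : Fintype.card {i // i ∈ V} = (V.erase 0).card + 1 := by
        rw [Fintype.card_coe, hc]
      have h3 : Fintype.card {i // i ∉ V} = n - (V.erase 0).card := by
        rw [Fintype.card_subtype_compl, Fintype.card_coe, Fintype.card_fin, ← hc]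
        omega
      rw [connectedIntegral_eq_fin h2, graphIntegral_eq_fin h3]
  -- The integrals depend only on |V|, and `n.choose k` sets contain 0 and k further vertices.
  rw [h1, Finset.sum_powerset_apply_card]
  simp [Finset.card_erase_of_mem, hF]

/-- The coefficients of the formal logarithm of the partition series. -/
theorem logOf_graphIntegral (hw : Measurable (Function.uncurry w))
    (hw_le : ∀ x y, ‖w x y‖ ≤ 1) (hξ : Integrable ξ μ) :
    PowerSeries.mk (fun n => (n ! : ℂ)⁻¹ * connectedIntegral (Fin n) w μ ξ) =
      PowerSeries.logOf (PowerSeries.mk fun n => (n ! : ℂ)⁻¹ * graphIntegral (Fin n) w μ ξ) := by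
  apply eq_logOf_of_mul_derivative
  · rw [← PowerSeries.coeff_zero_eq_constantCoeff_apply, PowerSeries.coeff_mk]
    simp [graphIntegral, graphSum_eq_prod, measureReal_def]
  · rw [← PowerSeries.coeff_zero_eq_constantCoeff_apply, PowerSeries.coeff_mk]
    have : ∀ G : SimpleGraph (Fin 0), ¬ G.Connected := fun G hG =>
      (hG.nonempty).elim fun i => i.elim0
    simp [connectedIntegral, connectedSum, this]
  · ext n
    -- After the swap k indexes the derivative of the logarithm, that is, a component of k + 1
    -- vertices.
    rw [PowerSeries.coeff_mul, PowerSeries.coeff_derivative, PowerSeries.coeff_mk,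
      graphIntegral_fin_succ hw hw_le hξ, ← Finset.Nat.sum_antidiagonal_swap,
      Finset.Nat.sum_antidiagonal_eq_sum_range_succ_mk, Finset.mul_sum, Finset.sum_mul]
    refine Finset.sum_congr rfl fun k hk => ?_
    have hk : k ≤ n := by simpa [Nat.lt_succ_iff] using hk
    simp only [Prod.swap_prod_mk, PowerSeries.coeff_mk, PowerSeries.coeff_derivative]
    rw [Nat.cast_choose ℂ hk, Nat.factorial_succ, Nat.factorial_succ]
    have h1 : ((n : ℂ) + 1) ≠ 0 := Nat.cast_add_one_ne_zero n
    have h2 : ((k : ℂ) + 1) ≠ 0 := Nat.cast_add_one_ne_zero k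
    have h3 : (n ! : ℂ) ≠ 0 := Nat.cast_ne_zero.2 n.factorial_ne_zero
    have h4 : (k ! : ℂ) ≠ 0 := Nat.cast_ne_zero.2 k.factorial_ne_zero
    have h5 : ((n - k)! : ℂ) ≠ 0 := Nat.cast_ne_zero.2 (n - k).factorial_ne_zero
    push_cast
    field_simp

end ClusterIntegral

/-! ### Product measures with densities -/

section ProductDensity

theorem lintegral_pi_fin_succ {S : Type*} [MeasurableSpace S] (μ : Measure S) [SigmaFinite μ]
    {n : ℕ} {g : (Fin (n + 1) → S) → ℝ≥0∞} (hg : Measurable g) :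
    ∫⁻ x, g x ∂(Measure.pi fun _ => μ) =
      ∫⁻ x, ∫⁻ y : Fin n → S, g (Fin.cons x y) ∂(Measure.pi fun _ => μ) ∂μ := by
  have hmp := (measurePreserving_piFinSuccAbove (fun _ : Fin (n + 1) => μ) 0).symm
  rw [← hmp.lintegral_comp hg, lintegral_prod
    (fun z => g ((MeasurableEquiv.piFinSuccAbove (fun _ : Fin (n + 1) => S) 0).symm z))
    (hg.comp hmp.measurable).aemeasurable]
  refine lintegral_congr fun x => lintegral_congr fun y => congrArg g ?_
  simp [MeasurableEquiv.piFinSuccAbove_symm_apply, Fin.insertNthEquiv]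

theorem lintegral_prod_pi_fin {S : Type*} [MeasurableSpace S] {n : ℕ} {μ : Fin n → Measure S}
    [∀ i, SigmaFinite (μ i)] {f : S → ℝ≥0∞} (hf : Measurable f) :
    ∫⁻ x, ∏ i, f (x i) ∂(Measure.pi μ) = ∏ i, ∫⁻ x, f x ∂(μ i) := by
  induction n with
  | zero => simp
  | succ n ih =>
    have hmp := (measurePreserving_piFinSuccAbove μ 0).symm
    have hm : ∀ k, Measurable fun x : Fin k → S => ∏ i, f (x i) := fun k =>
      Finset.measurable_prod _ fun i _ => hf.comp (measurable_pi_apply i)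
    rw [← hmp.lintegral_comp (hm _), Fin.prod_univ_succ, ← ih,
      ← lintegral_prod_mul hf.aemeasurable (hm n).aemeasurable]
    refine lintegral_congr fun x => ?_
    simp [MeasurableEquiv.piFinSuccAbove_symm_apply, Fin.insertNthEquiv, Fin.prod_univ_succ]

theorem pi_withDensity {S : Type*} [MeasurableSpace S] (μ : Measure S) [SigmaFinite μ] {n : ℕ}
    {f : S → ℝ≥0∞} (hf : Measurable f) [SigmaFinite (μ.withDensity f)] :
    Measure.pi (fun _ : Fin n => μ.withDensity f) =
      (Measure.pi fun _ => μ).withDensity fun x => ∏ i, f (x i) := by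
  refine Measure.pi_eq fun s hs => ?_
  rw [withDensity_apply _ (MeasurableSet.univ_pi hs), Measure.restrict_pi_pi,
    lintegral_prod_pi_fin hf]
  exact Finset.prod_congr rfl fun i _ => (withDensity_apply _ (hs i)).symm

end ProductDensity

/-! ### The partition function and its logarithm -/

section Partition

theorem norm_omega_le {X : Type*} {w : X → X → ℂ} (hw_le : ∀ x y, ‖w x y‖ ≤ 1)
    {n : ℕ} (x : Fin n → X) : ‖omega w x‖ ≤ 1 := by
  rw [omega, norm_prod]
  exact Finset.prod_le_one (fun _ _ => norm_nonneg _) fun _ _ => hw_le _ _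

variable {S : Type*} [MeasurableSpace S] {m : Measure S} {ξ : S → ℂ} {w : S → S → ℂ} {Λ : Set S}

theorem integrable_restrict (hξ : Measurable ξ) (hΛ : MeasurableSet Λ)
    (hfin : absMeasure m ξ Λ < ⊤) : Integrable ξ (m.restrict Λ) := by
  rw [absMeasure, withDensity_apply _ hΛ] at hfin
  exact ⟨hξ.aestronglyMeasurable, hfin⟩

theorem IsLogPartition.unique {L L' : ℂ} (h : IsLogPartition w m ξ Λ L)
    (h' : IsLogPartition w m ξ Λ L') : L = L' := by
  obtain ⟨l, hl, hl0, rfl, he⟩ := h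
  obtain ⟨l', hl', hl0', rfl, he'⟩ := h'
  exact eqOn_of_exp_eq hl hl' (hl0.trans hl0'.symm)
    (fun t ht => (he t ht).trans (he' t ht).symm) (Set.right_mem_Icc.2 zero_le_one)

theorem partitionTerm_smul (n : ℕ) (t : ℂ) :
    partitionTerm w m (fun x => t * ξ x) Λ n = partitionTerm w m ξ Λ n * t ^ n := by
  have h : ∀ x : Fin n → S, omega w x * ∏ i, (t * ξ (x i)) =
      (omega w x * ∏ i, ξ (x i)) * t ^ n := fun x => by
    rw [Finset.prod_mul_distrib, Finset.prod_const, Finset.card_univ, Fintype.card_fin]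
    ring
  simp only [partitionTerm, h]
  rw [integral_mul_const, mul_assoc]

variable [SigmaFinite m]

theorem sigmaFinite_absMeasure (m : Measure S) [SigmaFinite m] (ξ : S → ℂ) :
    SigmaFinite (absMeasure m ξ) :=
  SigmaFinite.withDensity_of_ne_top (by simp)

theorem partitionTerm_eq_graphIntegral (n : ℕ) :
    partitionTerm w m ξ Λ n = (n ! : ℂ)⁻¹ * graphIntegral (Fin n) w (m.restrict Λ) ξ := by
  rw [partitionTerm, graphIntegral, Measure.restrict_pi_pi]
  simp only [omega_eq_graphSum]

theorem partitionTerm_zero : partitionTerm w m ξ Λ 0 = 1 := by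
  simp [partitionTerm, omega, measureReal_def]

theorem coeff_logPartitionSeries (hw : Measurable (Function.uncurry w))
    (hw_le : ∀ x y, ‖w x y‖ ≤ 1) (hξ : Integrable ξ (m.restrict Λ)) (n : ℕ) :
    PowerSeries.coeff n (logPartitionSeries w m ξ Λ) =
      (n ! : ℂ)⁻¹ * connectedIntegral (Fin n) w (m.restrict Λ) ξ := by
  have h := logOf_graphIntegral hw hw_le hξ
  simp only [← partitionTerm_eq_graphIntegral] at h
  rw [logPartitionSeries, partitionSeries, ← h, PowerSeries.coeff_mk]

/-- As |ω| ≤ 1, the n-th term is at most |ν|(Λ)^n / n!. -/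
theorem summable_norm_partitionTerm (hw_le : ∀ x y, ‖w x y‖ ≤ 1)
    (hξ : Integrable ξ (m.restrict Λ)) : Summable fun n => ‖partitionTerm w m ξ Λ n‖ := by
  refine Summable.of_nonneg_of_le (fun _ => norm_nonneg _) (fun n => ?_)
    (Real.summable_pow_div_factorial (∫ x in Λ, ‖ξ x‖ ∂m))
  rw [partitionTerm, Measure.restrict_pi_pi, norm_mul, norm_inv, Complex.norm_natCast, mul_comm,
    div_eq_mul_inv]
  gcongr
  have h := integral_fintype_prod_eq_prod (ι := Fin n) (𝕜 := ℝ) (fun _ x => ‖ξ x‖)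
    (μ := fun _ => m.restrict Λ)
  rw [Finset.prod_const, Finset.card_univ, Fintype.card_fin] at h
  rw [← h]
  refine norm_integral_le_of_norm_le (Integrable.fintype_prod fun _ => hξ.norm)
    (Filter.Eventually.of_forall fun x => ?_)
  rw [norm_mul, norm_prod]
  exact mul_le_of_le_one_left (Finset.prod_nonneg fun _ _ => norm_nonneg _) (norm_omega_le hw_le x)

theorem measurable_enorm_omegaT (hw : Measurable (Function.uncurry w)) (n : ℕ) :
    Measurable fun x : Fin n → S => ‖omegaT w x‖ₑ :=
  (measurable_connectedSum hw).enorm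

theorem measurable_absGammaTerm (hw : Measurable (Function.uncurry w)) (n : ℕ) : Measurable (absGammaTerm w m ξ n) := by
  have := sigmaFinite_absMeasure m ξ
  have hcons : Measurable fun q : S × (Fin n → S) => (Fin.cons q.1 q.2 : Fin (n + 1) → S) := by
    refine measurable_pi_lambda _ fun i => ?_
    refine Fin.cases ?_ (fun j => ?_) i
    · simpa using measurable_fst
    · simpa [Function.comp_def] using (measurable_pi_apply j).comp measurable_snd
  exact (((measurable_enorm_omegaT hw (n + 1)).comp hcons).lintegral_prod_right').const_mul _

theorem absGammaTerm_zero (x : S) : absGammaTerm w m ξ 0 x = 1 := by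
  classical
  have := sigmaFinite_absMeasure m ξ
  have h : ∀ y : Fin 1 → S, omegaT w y = 1 := fun y => by
    have hc : (⊥ : SimpleGraph (Fin 1)).Connected := SimpleGraph.IsTree.of_subsingleton.connected
    have h1 : ∀ G : SimpleGraph (Fin 1), G = ⊥ := fun G => Subsingleton.elim _ _
    have h2 : (Finset.univ.filter fun G : SimpleGraph (Fin 1) => G.Connected) = {⊥} := by
      ext G
      simp [h1 G, hc]
    rw [omegaT_eq_sum_edgePairs, h2, Finset.sum_singleton]
    refine Finset.prod_eq_one fun p hp => ?_
    simp [mem_edgePairs] at hp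
  simp [absGammaTerm, h]

theorem absGamma_eq_tsum (x : S) :
    absGamma w m ξ x = ∑' n, absGammaTerm w m ξ n x := by
  rw [absGamma, tsum_eq_zero_add' (f := fun n => absGammaTerm w m ξ n x) ENNReal.summable,
    absGammaTerm_zero]

theorem lintegral_absGamma (hw : Measurable (Function.uncurry w)) (Λ : Set S) :
    ∫⁻ x in Λ, absGamma w m ξ x ∂(absMeasure m ξ) =
      ∑' n, ∫⁻ x in Λ, absGammaTerm w m ξ n x ∂(absMeasure m ξ) := by
  simp only [absGamma_eq_tsum]
  exact lintegral_tsum fun n => (measurable_absGammaTerm hw n).aemeasurable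

theorem enorm_connectedIntegral_le (hw : Measurable (Function.uncurry w)) (hξ : Measurable ξ)
    (hΛ : MeasurableSet Λ) (n : ℕ) :
    ‖connectedIntegral (Fin (n + 1)) w (m.restrict Λ) ξ‖ₑ ≤
      ∫⁻ x in Λ, ∫⁻ y : Fin n → S, ‖omegaT w (Fin.cons x y : Fin (n + 1) → S)‖ₑ
        ∂(Measure.pi fun _ => absMeasure m ξ) ∂(absMeasure m ξ) := by
  have := sigmaFinite_absMeasure m ξ
  have hrestr : (absMeasure m ξ).restrict Λ = (m.restrict Λ).withDensity fun x => ‖ξ x‖ₑ :=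
    restrict_withDensity hΛ _
  have : SigmaFinite ((m.restrict Λ).withDensity fun x => ‖ξ x‖ₑ) := by
    rw [← hrestr]
    infer_instance
  have hmeas := measurable_enorm_omegaT hw (n + 1)
  have hprod : Measurable fun x : Fin (n + 1) → S => ∏ i, ‖ξ (x i)‖ₑ :=
    Finset.measurable_prod _ fun i _ => hξ.enorm.comp (measurable_pi_apply i)
  calc ‖connectedIntegral (Fin (n + 1)) w (m.restrict Λ) ξ‖ₑ
      ≤ ∫⁻ x : Fin (n + 1) → S, ‖omegaT w x * ∏ i, ξ (x i)‖ₑ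
          ∂(Measure.pi fun _ => m.restrict Λ) := enorm_integral_le_lintegral_enorm _
    _ = ∫⁻ x : Fin (n + 1) → S, ‖omegaT w x‖ₑ
          ∂(Measure.pi fun _ => (absMeasure m ξ).restrict Λ) := by
        rw [hrestr, pi_withDensity _ hξ.enorm,
          lintegral_withDensity_eq_lintegral_mul _ hprod hmeas]
        refine lintegral_congr fun x => ?_
        rw [enorm_mul, enorm_finset_prod, mul_comm]
        rfl
    _ = ∫⁻ x in Λ, ∫⁻ y : Fin n → S, ‖omegaT w (Fin.cons x y : Fin (n + 1) → S)‖ₑ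
          ∂(Measure.pi fun _ => (absMeasure m ξ).restrict Λ) ∂(absMeasure m ξ) :=
        lintegral_pi_fin_succ _ hmeas
    -- Only the pinned point stays in Λ; the domain of the others grows from Λ^n to S^n.
    _ ≤ _ := by
        refine lintegral_mono fun x => ?_
        rw [← Measure.restrict_pi_pi]
        exact lintegral_mono' Measure.restrict_le_self le_rfl

theorem enorm_coeff_succ_logPartitionSeries_le (hw : Measurable (Function.uncurry w))
    (hw_le : ∀ x y, ‖w x y‖ ≤ 1) (hξ : Measurable ξ) (hΛ : MeasurableSet Λ)
    (hfin : absMeasure m ξ Λ < ⊤) (n : ℕ) :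
    ‖PowerSeries.coeff (n + 1) (logPartitionSeries w m ξ Λ)‖ₑ ≤
      ∫⁻ x in Λ, absGammaTerm w m ξ n x ∂(absMeasure m ξ) := by
  rw [coeff_logPartitionSeries hw hw_le (integrable_restrict hξ hΛ hfin), enorm_mul]
  simp only [absGammaTerm]
  rw [lintegral_const_mul' _ _ (by simp [Nat.factorial_ne_zero])]
  -- The coefficient carries 1/(n+1)!, the pinned term only 1/n!.
  refine mul_le_mul' ?_ (enorm_connectedIntegral_le hw hξ hΛ n)
  have hne : ((n + 1)! : ℂ) ≠ 0 := Nat.cast_ne_zero.2 (n + 1).factorial_ne_zero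
  rw [enorm_inv hne, ENNReal.inv_le_inv]
  have : ‖((n + 1)! : ℂ)‖ₑ = ((n + 1)! : ℝ≥0∞) := by simp [enorm_eq_nnnorm]
  rw [this]
  exact_mod_cast Nat.factorial_le n.le_succ

theorem coeff_zero_logPartitionSeries :
    PowerSeries.coeff 0 (logPartitionSeries w m ξ Λ) = 0 := by
  rw [PowerSeries.coeff_zero_eq_constantCoeff_apply, logPartitionSeries]
  apply PowerSeries.constantCoeff_logOf
  rw [← PowerSeries.coeff_zero_eq_constantCoeff_apply, partitionSeries, PowerSeries.coeff_mk,
    partitionTerm_zero]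

theorem tsum_enorm_coeff_le (hw : Measurable (Function.uncurry w))
    (hw_le : ∀ x y, ‖w x y‖ ≤ 1) (hξ : Measurable ξ) (hΛ : MeasurableSet Λ)
    (hfin : absMeasure m ξ Λ < ⊤) :
    ∑' n, ‖PowerSeries.coeff n (logPartitionSeries w m ξ Λ)‖ₑ ≤
      ∫⁻ x in Λ, absGamma w m ξ x ∂(absMeasure m ξ) := by
  rw [lintegral_absGamma hw, tsum_eq_zero_add' ENNReal.summable, coeff_zero_logPartitionSeries,
    enorm_zero, zero_add]
  exact ENNReal.tsum_le_tsum (enorm_coeff_succ_logPartitionSeries_le hw hw_le hξ hΛ hfin)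

theorem summable_norm_of_tsum_enorm_lt_top {c : ℕ → ℂ} (h : ∑' n, ‖c n‖ₑ < ⊤) :
    Summable fun n => ‖c n‖ := by
  have h1 : Summable fun n => ‖c n‖₊ := ENNReal.tsum_coe_ne_top_iff_summable.1 h.ne
  simpa using NNReal.summable_coe.2 h1

theorem partitionFunction_smul (hw_le : ∀ x y, ‖w x y‖ ≤ 1)
    (hξ : Integrable ξ (m.restrict Λ)) {t : ℂ} (ht : ‖t‖ ≤ 1) :
    partitionFunction w m (fun x => t * ξ x) Λ = ∑' n, partitionTerm w m ξ Λ n * t ^ n := by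
  have hs := (summable_norm_mul_pow (summable_norm_partitionTerm hw_le hξ) ht).of_norm
  rw [hs.tsum_eq_zero_add, partitionFunction]
  simp only [partitionTerm_smul, partitionTerm_zero, pow_zero, mul_one]

theorem exp_tsum_coeff_eq (hw_le : ∀ x y, ‖w x y‖ ≤ 1) (hξ : Integrable ξ (m.restrict Λ))
    (hc : Summable fun n => ‖PowerSeries.coeff n (logPartitionSeries w m ξ Λ)‖) {t : ℝ}
    (ht : t ∈ Set.Icc (0 : ℝ) 1) :
    Complex.exp (∑' n, PowerSeries.coeff n (logPartitionSeries w m ξ Λ) * (t : ℂ) ^ n) =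
      partitionFunction w m (fun x => (t : ℂ) * ξ x) Λ := by
  rw [partitionFunction_smul hw_le hξ (by
    rw [Complex.norm_real, Real.norm_of_nonneg ht.1]
    exact ht.2)]
  refine exp_tsum_eq_tsum (summable_norm_partitionTerm hw_le hξ) hc partitionTerm_zero
    coeff_zero_logPartitionSeries (fun n => ?_) ht
  have h1 : PowerSeries.constantCoeff (partitionSeries w m ξ Λ) = 1 := by
    rw [← PowerSeries.coeff_zero_eq_constantCoeff_apply, partitionSeries, PowerSeries.coeff_mk,
      partitionTerm_zero]
  have h2 := congrArg (PowerSeries.coeff n) (mul_derivative_logOf h1)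
  rw [PowerSeries.coeff_mul, PowerSeries.coeff_derivative, partitionSeries,
    PowerSeries.coeff_mk, mul_comm] at h2
  rw [← h2]
  refine Finset.sum_congr rfl fun p _ => ?_
  rw [PowerSeries.coeff_mk, PowerSeries.coeff_derivative, logPartitionSeries, partitionSeries]
  ring

theorem isLogPartition_tsum (hw_le : ∀ x y, ‖w x y‖ ≤ 1) (hξ : Integrable ξ (m.restrict Λ))
    (hc : Summable fun n => ‖PowerSeries.coeff n (logPartitionSeries w m ξ Λ)‖) :
    IsLogPartition w m ξ Λ (∑' n, PowerSeries.coeff n (logPartitionSeries w m ξ Λ)) := by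
  refine ⟨fun t => ∑' n, PowerSeries.coeff n (logPartitionSeries w m ξ Λ) * (t : ℂ) ^ n,
    continuousOn_tsum_mul_ofReal_pow hc, ?_, by simp, fun t ht => exp_tsum_coeff_eq hw_le hξ hc ht⟩
  simp only
  rw [tsum_eq_single 0 fun n hn => by simp [hn], coeff_zero_logPartitionSeries, zero_mul]

end Partition

end ClusterExp

open MeasureTheory ClusterExp in
theorem mainTheorem2 {S : Type*} [MeasurableSpace S] (m : Measure S) [SigmaFinite m]
    (ξ : S → ℂ) (hξ : Measurable ξ)
    (w : S → S → ℂ) (hw : Measurable (Function.uncurry w))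
    (hw_symm : ∀ x y, w x y = w y x) (hw_le : ∀ x y, ‖w x y‖ ≤ 1) :
    -- `|Γ|(ν)(x) ≤ 𝓑(ν)(x)`, term by term and as a bound in `[0,∞]`
    (∀ x : S, (∀ n : ℕ, absGammaTerm w m ξ n x ≤ treeSumTerm w m ξ n x) ∧
      absGamma w m ξ x ≤ treeSum w m ξ x) ∧
    -- `|ln Ξ_Λ(ν)| ≤ ∫_Λ |Γ|(ν) d|ν|`
    ∀ Λ : Set S, MeasurableSet Λ → absMeasure m ξ Λ < ⊤ →
      -- term by term, as power series in `z` after replacing `ν` by `zν`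
      (PowerSeries.coeff 0 (logPartitionSeries w m ξ Λ) = 0 ∧
        ∀ n : ℕ, ‖PowerSeries.coeff (n + 1) (logPartitionSeries w m ξ Λ)‖ₑ ≤
          ∫⁻ x in Λ, absGammaTerm w m ξ n x ∂(absMeasure m ξ)) ∧
      -- as a bound between numbers
      (∀ L : ℂ, IsLogPartition w m ξ Λ L →
        ‖L‖ₑ ≤ ∫⁻ x in Λ, absGamma w m ξ x ∂(absMeasure m ξ)) ∧
      -- when the right-hand side is finite, `ln Ξ_Λ(ν)` exists and is the sum of its expansion
      (∫⁻ x in Λ, absGamma w m ξ x ∂(absMeasure m ξ) < ⊤ →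
        ∃ L : ℂ, IsLogPartition w m ξ Λ L ∧
          HasSum (fun n => PowerSeries.coeff n (logPartitionSeries w m ξ Λ)) L) := by
  have hterm : ∀ (x : S) (n : ℕ), absGammaTerm w m ξ n x ≤ treeSumTerm w m ξ n x :=
    fun x n => mul_le_mul_right (lintegral_mono fun y =>
      enorm_omegaT_le_treeWeight hw_symm hw_le _) _
  refine ⟨fun x => ⟨hterm x, ?_⟩, fun Λ hΛ hfin => ?_⟩
  · exact add_le_add_right (ENNReal.tsum_le_tsum fun n => hterm x (n + 1)) _
  have hint := integrable_restrict hξ hΛ hfin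
  have hle := tsum_enorm_coeff_le hw hw_le hξ hΛ hfin
  refine ⟨⟨coeff_zero_logPartitionSeries,
    enorm_coeff_succ_logPartitionSeries_le hw hw_le hξ hΛ hfin⟩, fun L hL => ?_, fun hlt => ?_⟩
  · rcases eq_or_ne (∫⁻ x in Λ, absGamma w m ξ x ∂(absMeasure m ξ)) ⊤ with htop | htop
    · rw [htop]
      exact le_top
    · have hc := summable_norm_of_tsum_enorm_lt_top (hle.trans_lt htop.lt_top)
      -- By uniqueness any admissible L is the sum of the series.
      rw [hL.unique (isLogPartition_tsum hw_le hint hc)]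
      exact (enorm_tsum_le_tsum_enorm).trans hle
  · have hc := summable_norm_of_tsum_enorm_lt_top (hle.trans_lt hlt)
    exact ⟨_, isLogPartition_tsum hw_le hint hc, hc.of_norm.hasSum⟩
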